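/- Let $S^1=\mathbb R/\mathbb Z$ (that is, $[0,1]$ with its end points identified), let $p\in[1,\infty)$ and $s\ge 0$, and write $s=k+\sigma$ with $k\in\mathbb N_0$, $\sigma\in[0,1)$. For a smooth vector field (equivalently, a smooth $1$-periodic function) $u$ on $S^1$ let $$\|u\|_{W^{s,p}}=\sum_{j=0}^{k}\|u^{(j)}\|_{L^p(S^1)}+\Big(\iint_{S^1\times S^1}\frac{|u^{(k)}(x)-u^{(k)}(y)|^p}{d(x,y)^{1+\sigma p}}\,dx\,dy\Big)^{1/p},$$ where $d$ is the distance on $S^1$ and the last term is omitted if $\sigma=0$. Let $\operatorname{Diff}(S^1)$ be the connected component of the identity in the group of smooth diffeomorphisms of $S^1$. For a norm $N$ on the smooth vector fields put $$\operatorname{dist}_N(\varphi_0,\varphi_1)=\inf\int_0^1 N(\partial_t\varphi_t\circ\varphi_t^{-1})\,dt,$$ the infimum being over smooth paths $\varphi:[0,1]\to\operatorname{Diff}(S^1)$ from $\varphi_0$ to $\varphi_1$, and for $A\subset S^1$ define the displacement energy $$E_N(A)=\inf\{\operatorname{dist}_N(\mathrm{Id},\varphi)\;:\;\varphi\in\operatorname{Diff}(S^1),\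 \varphi(A)\cap A=\emptyset\}\in[0,\infty],\qquad \inf\emptyset=\infty .$$ Write $E_{s,p}=E_N$ for $N=\|\cdot\|_{W^{s,p}}$. Then: 1. For every interval (arc) $I$ in $S^1$ of length smaller than $1/2$, $E_{s,p}(I)\le 1/2$. 2. If $s<1+1/p$, there exists $C=C(s,p)>0$ such that $E_{s,p}(I)<C$ for every open interval (arc) $I$ in $S^1$ of length smaller than $1$. 3. If $s>1+1/p$, there exists $c=c(s,p)>0$ such that $E_{s,p}((0,1-\delta))>c\,|\log\delta|$ for every $\delta\in(0,1)$. Moreover, 2 and 3 hold for $E_N$ with any norm $N$ (more generally, any $[0,\infty]$-valued functional $N$) that is equivalent to $\|\cdot\|_{W^{s,p}}$ on the smooth vector fields, in the sense that each is bounded by a constant multiple of the other, with constants depending also on $N$. -/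

import Mathlib

open MeasureTheory Set
open scoped ENNReal NNReal ContDiff

noncomputable section

namespace CircleDiff

/-! The circle is `ℝ / ℤ` (`UnitAddCircle`), a circle of length one.  Functions and vector fields
on it are written as `1`-periodic functions `ℝ → ℝ`. -/

/-- The Gagliardo (Slobodeckij) seminorm of order `σ ∈ (0,1)` of a `1`-periodic function `g`:
`(∬ |g x - g y|^p / d(x,y)^(1 + σ p) dx dy)^(1/p)` over `S¹ × S¹`, where `d` is the distance on
the circle `ℝ / ℤ`. -/
def gagliardo (σ p : ℝ) (g : ℝ → ℝ) : ℝ≥0∞ :=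
  (∫⁻ x in Ioc (0 : ℝ) 1, ∫⁻ y in Ioc (0 : ℝ) 1,
    ‖g x - g y‖ₑ ^ p / edist (x : UnitAddCircle) (y : UnitAddCircle) ^ (1 + σ * p)) ^ (1 / p)

/-- The integer order Sobolev norm `‖f‖_{W^{k,p}(S¹)} = ∑_{j ≤ k} ‖f^{(j)}‖_{L^p(S¹)}` of a
smooth `1`-periodic function. -/
def intSobolevNorm (k : ℕ) (p : ℝ) (f : ℝ → ℝ) : ℝ≥0∞ :=
  ∑ j ∈ Finset.range (k + 1),
    eLpNorm (iteratedDeriv j f) (ENNReal.ofReal p) (volume.restrict (Ioc (0 : ℝ) 1))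

/-- The Sobolev-Slobodeckij norm `‖f‖_{W^{s,p}(S¹)}`, `s ≥ 0`, of a smooth `1`-periodic function.
With `k = ⌊s⌋` and `σ = s - k` it is `‖f‖_{W^{k,p}}` if `σ = 0`, and `‖f‖_{W^{k,p}}` plus the
Gagliardo seminorm of order `σ` of `f^{(k)}` if `σ ∈ (0,1)`. -/
def sobolevNorm (s p : ℝ) (f : ℝ → ℝ) : ℝ≥0∞ :=
  intSobolevNorm ⌊s⌋₊ p f +
    if s = ⌊s⌋₊ then 0 else gagliardo (s - ⌊s⌋₊) p (iteratedDeriv ⌊s⌋₊ f)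

/-- `N` is equivalent to the `W^{s,p}`-norm on the smooth vector fields on the circle. -/
def EquivSobolevNorm (s p : ℝ) (N : (ℝ → ℝ) → ℝ≥0∞) : Prop :=
  ∃ K : ℝ≥0, ∀ f : ℝ → ℝ, ContDiff ℝ ∞ f → Function.Periodic f 1 →
    N f ≤ K * sobolevNorm s p f ∧ sobolevNorm s p f ≤ K * N f

/-- `F : ℝ → ℝ` is a lift of an orientation preserving smooth diffeomorphism of `ℝ / ℤ`. -/
structure IsDiffeoLift (F : ℝ → ℝ) : Prop where
  smooth : ContDiff ℝ ∞ F
  add_one : ∀ x, F (x + 1) = F x + 1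
  deriv_pos : ∀ x, 0 < deriv F x

/-- The connected component of the identity of `Diff(S¹)`, that is, the orientation preserving
smooth diffeomorphisms of `ℝ / ℤ`. -/
structure Diffeo where
  toFun : UnitAddCircle → UnitAddCircle
  exists_lift : ∃ F : ℝ → ℝ, IsDiffeoLift F ∧ ∀ x : ℝ, toFun (x : UnitAddCircle) = (F x : ℝ)

/-- The identity diffeomorphism. -/
def Diffeo.id : Diffeo where
  toFun := fun θ => θ
  exists_lift := ⟨fun x => x, ⟨contDiff_id, fun _ => rfl, fun x => by simp⟩, fun _ => rfl⟩

/-- `Φ` is (a lift to the real line of) a smooth path `t ↦ Φ t`, `t ∈ [0,1]`, of diffeomorphisms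
of the circle from `φ₀` to `φ₁`. Smoothness is joint in time and space; values of `Φ` at times
outside `[0,1]` only serve to express smoothness up to the end points. -/
structure IsPath (Φ : ℝ → ℝ → ℝ) (φ₀ φ₁ : Diffeo) : Prop where
  smooth : ContDiff ℝ ∞ (fun q : ℝ × ℝ => Φ q.1 q.2)
  diffeo : ∀ t ∈ Icc (0 : ℝ) 1, IsDiffeoLift (Φ t)
  source : ∀ x : ℝ, φ₀.toFun (x : UnitAddCircle) = (Φ 0 x : ℝ)
  target : ∀ x : ℝ, φ₁.toFun (x : UnitAddCircle) = (Φ 1 x : ℝ)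

/-- The vector field `∂ₜ Φ ∘ (Φ t)⁻¹` on the circle, as a `1`-periodic function. -/
def velocity (Φ : ℝ → ℝ → ℝ) (t : ℝ) : ℝ → ℝ :=
  fun y => deriv (fun τ => Φ τ (Function.invFun (Φ t) y)) t

/-- The length `∫₀¹ N(∂ₜ Φ ∘ (Φ t)⁻¹) dt` of a path for the right-invariant Finsler metric that is
`N` on the Lie algebra of vector fields. -/
def pathLength (N : (ℝ → ℝ) → ℝ≥0∞) (Φ : ℝ → ℝ → ℝ) : ℝ≥0∞ :=
  ∫⁻ t in Icc (0 : ℝ) 1, N (velocity Φ t)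

/-- The geodesic distance of the right-invariant Finsler metric given by `N`. -/
def geodesicDist (N : (ℝ → ℝ) → ℝ≥0∞) (φ₀ φ₁ : Diffeo) : ℝ≥0∞ :=
  ⨅ (Φ : ℝ → ℝ → ℝ) (_ : IsPath Φ φ₀ φ₁), pathLength N Φ

/-- The displacement energy `inf {dist(Id, φ) : φ(A) ∩ A = ∅}` of a subset of the circle; it is
`∞` if no such `φ` exists. -/
def displacementEnergy (N : (ℝ → ℝ) → ℝ≥0∞) (A : Set UnitAddCircle) : ℝ≥0∞ :=
  ⨅ (φ : Diffeo) (_ : φ.toFun '' A ∩ A = ∅), geodesicDist N Diffeo.id φ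

/-- The subset of the circle `ℝ / ℤ` covered by `I ⊆ ℝ`. -/
def arc (I : Set ℝ) : Set UnitAddCircle :=
  (fun x : ℝ => (x : UnitAddCircle)) '' I

end CircleDiff

end

noncomputable section

namespace CircleDiff

/-! ### Integrals of periodic functions -/

/-! For short arcs the half rotation displaces, and its affine path has constant velocity `1/2`,
whose Sobolev norm is `1/2`.

Below the critical exponent, the displacing map is a hyperbolic Möbius map, which shrinks the arc
about its centre, followed by a half rotation (`exists_abs_mobiusLift_lt`). It is joined to the
identity by the affine path `x + t (F x - x)`. The velocity `v` satisfies `v' = (F' - 1) / (1 + t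
(F' - 1))` at the moved point. Whatever `F` is, this lies between `-1/(1-t)` and `1/t`, so `|v'| ≤
M` with `M = 1/t + 1/(1-t)`. Moreover `∫ |v'| ≤ 2`, and since `F'` is unimodal so is `v'`, whence `∫
|v''| ≤ 4 M` (`controlled_velocity_affinePath`). Interpolating between these bounds gives a Sobolev
norm of order `M ^ θ` with `θ < 1` exactly because `s < 1 + 1/p`
(`sublinearOnControlled_sobolevNorm`). As `M ^ θ` is integrable in `t`, the length is bounded
independently of how strongly `F` contracts (`exists_pathLength_affinePath_le`).

Above the critical exponent, the norm controls the `C¹` norm, by a fractional Morrey inequality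
(`exists_enorm_deriv_le_sobolevNorm`). Along a path the logarithm of the length of an arc then
changes at a rate bounded by the norm of the velocity (`IsPath.enorm_log_sub_log_le`). Displacing an
arc of length `1 - δ` squeezes it into a gap of length `δ`, which costs a multiple of `log ((1 - δ)
/ δ)`. For `δ` near `1`, where this is no longer useful, the distance travelled by the midpoint
suffices.

Both arguments use the norm only up to constant factors, hence the extension to equivalent
functionals. -/

lemma setLIntegral_Ioc_comp_add_right (f : ℝ → ℝ≥0∞) (a b s : ℝ) :
    ∫⁻ x in Ioc a b, f (x + s) = ∫⁻ x in Ioc (a + s) (b + s), f x := by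
  have h := (measurePreserving_add_right (volume : Measure ℝ) s).setLIntegral_comp_preimage_emb
    (measurableEmbedding_addRight s) f (Ioc (a + s) (b + s))
  rw [← h]
  simp

lemma setLIntegral_Ioc_comp_add_left (f : ℝ → ℝ≥0∞) (a b s : ℝ) :
    ∫⁻ x in Ioc a b, f (s + x) = ∫⁻ x in Ioc (s + a) (s + b), f x := by
  simp_rw [add_comm s]
  exact setLIntegral_Ioc_comp_add_right f a b s

lemma setLIntegral_Ioc_add_one {f : ℝ → ℝ≥0∞} (hf : Function.Periodic f 1) (a : ℝ) :
    ∫⁻ x in Ioc a (a + 1), f x = ∫⁻ x in Ioc (0 : ℝ) 1, f x := by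
  have h1 := UnitAddCircle.lintegral_preimage a hf.lift
  have h2 := UnitAddCircle.lintegral_preimage 0 hf.lift
  rw [zero_add] at h2
  exact h1.trans h2.symm

lemma setLIntegral_Ioc_periodic_shift {f : ℝ → ℝ≥0∞} (hf : Function.Periodic f 1) (s : ℝ) :
    ∫⁻ x in Ioc (0 : ℝ) 1, f (x + s) = ∫⁻ x in Ioc (0 : ℝ) 1, f x := by
  rw [setLIntegral_Ioc_comp_add_right, zero_add, add_comm 1 s, setLIntegral_Ioc_add_one hf]

lemma setLIntegral_periodic_mono {f : ℝ → ℝ≥0∞} (hf : Function.Periodic f 1) {a b : ℝ}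
    (hab : b ≤ a + 1) : ∫⁻ x in Ioc a b, f x ≤ ∫⁻ x in Ioc (0 : ℝ) 1, f x := by
  rw [← setLIntegral_Ioc_add_one hf a]
  exact lintegral_mono_set (Ioc_subset_Ioc_right hab)

lemma enorm_sub_le_lintegral_deriv {g : ℝ → ℝ} (hg : ContDiff ℝ 1 g) {x h : ℝ} :
    ‖g (x + h) - g x‖ₑ ≤ ∫⁻ s in uIoc 0 h, ‖deriv g (x + s)‖ₑ := by
  have hd : ∀ s, HasDerivAt (fun s => g (x + s)) (deriv g (x + s)) s := fun s => by
    have := (hg.differentiable one_ne_zero (x + s)).hasDerivAt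
    exact this.comp_const_add x s
  have hc : Continuous (fun s => deriv g (x + s)) :=
    (hg.continuous_deriv le_rfl).comp (continuous_const.add continuous_id)
  have h1 := intervalIntegral.integral_eq_sub_of_hasDerivAt (a := 0) (b := h)
    (fun s _ => hd s) (hc.intervalIntegrable _ _)
  simp only [add_zero] at h1
  rw [← h1]
  have : ‖∫ s in (0 : ℝ)..h, deriv g (x + s)‖ₑ = ‖∫ s in uIoc 0 h, deriv g (x + s)‖ₑ := by
    rw [← ofReal_norm, ← ofReal_norm,
      intervalIntegral.norm_intervalIntegral_eq]
  rw [this]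
  exact enorm_integral_le_lintegral_enorm _

lemma volume_uIoc_zero (h : ℝ) : volume (uIoc 0 h) = ‖h‖ₑ := by
  rw [uIoc, Real.volume_Ioc, ← ofReal_norm, Real.norm_eq_abs]
  congr 1
  rw [max_sub_min_eq_abs]
  simp

/-- Translates of a periodic function differ in `L¹` by at most the total variation times the
length of the translation. -/
lemma lintegral_enorm_shift_sub_le {g : ℝ → ℝ} (hg : ContDiff ℝ 1 g)
    (hper : Function.Periodic g 1) (h : ℝ) :
    ∫⁻ x in Ioc (0 : ℝ) 1, ‖g (x + h) - g x‖ₑ ≤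
      ‖h‖ₑ * ∫⁻ x in Ioc (0 : ℝ) 1, ‖deriv g x‖ₑ := by
  have hc : Continuous (deriv g) := hg.continuous_deriv le_rfl
  have hp : Function.Periodic (fun x => ‖deriv g x‖ₑ) 1 := fun x => by
    have h1 : (fun y => g (y + 1)) = g := funext hper
    have h2 := deriv_comp_add_const g 1 x
    rw [h1] at h2
    simp only [h2]
  calc ∫⁻ x in Ioc (0 : ℝ) 1, ‖g (x + h) - g x‖ₑ
      ≤ ∫⁻ x in Ioc (0 : ℝ) 1, ∫⁻ s in uIoc 0 h, ‖deriv g (x + s)‖ₑ :=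
        lintegral_mono fun x => enorm_sub_le_lintegral_deriv hg
    _ = ∫⁻ s in uIoc 0 h, ∫⁻ x in Ioc (0 : ℝ) 1, ‖deriv g (x + s)‖ₑ := by
        apply lintegral_lintegral_swap
        apply Measurable.aemeasurable
        apply Continuous.measurable
        fun_prop
    _ = ∫⁻ s in uIoc 0 h, ∫⁻ x in Ioc (0 : ℝ) 1, ‖deriv g x‖ₑ := by
        congr 1
        ext s
        exact setLIntegral_Ioc_periodic_shift hp s
    _ = _ := by
        rw [lintegral_const, Measure.restrict_apply_univ, volume_uIoc_zero, mul_comm]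

lemma periodic_deriv {g : ℝ → ℝ} (hper : Function.Periodic g 1) :
    Function.Periodic (deriv g) 1 := fun x => by
  have h1 : (fun y => g (y + 1)) = g := funext hper
  have h2 := deriv_comp_add_const g 1 x
  rw [h1] at h2
  exact h2.symm

/-! ### The Gagliardo seminorm in terms of translations -/

lemma edist_coe_add {x h : ℝ} (hh : h ∈ Ioc (-1 / 2 : ℝ) (1 / 2)) :
    edist (x : UnitAddCircle) ((x + h : ℝ) : UnitAddCircle) = ‖h‖ₑ := by
  rw [edist_comm, edist_dist, dist_eq_norm, ← AddCircle.coe_sub, add_sub_cancel_left,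
    ← ofReal_norm]
  congr 1
  rw [Real.norm_eq_abs]
  refine (AddCircle.norm_coe_eq_abs_iff (p := 1) one_ne_zero).2 ?_
  rw [abs_one, abs_le]
  exact ⟨by linarith [hh.1], hh.2⟩

/-- Substitute `y = x + h`, with `h` in the fundamental domain on which the circle distance is
`|h|`, and exchange the integrals. -/
lemma gagliardo_lintegral_eq {g : ℝ → ℝ} (hg : Continuous g) (hper : Function.Periodic g 1)
    (σ p : ℝ) :
    (∫⁻ x in Ioc (0 : ℝ) 1, ∫⁻ y in Ioc (0 : ℝ) 1,
      ‖g x - g y‖ₑ ^ p / edist (x : UnitAddCircle) (y : UnitAddCircle) ^ (1 + σ * p)) =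
    ∫⁻ h in Ioc (-1 / 2 : ℝ) (1 / 2),
      (∫⁻ x in Ioc (0 : ℝ) 1, ‖g (x + h) - g x‖ₑ ^ p) / ‖h‖ₑ ^ (1 + σ * p) := by
  have hcoe : ∀ y : ℝ, ((y + 1 : ℝ) : UnitAddCircle) = (y : UnitAddCircle) := fun y => by simp
  calc _ = ∫⁻ x in Ioc (0 : ℝ) 1, ∫⁻ h in Ioc (-1 / 2 : ℝ) (1 / 2),
      ‖g (x + h) - g x‖ₑ ^ p / ‖h‖ₑ ^ (1 + σ * p) := by
        congr 1
        ext x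
        rw [← setLIntegral_Ioc_add_one _ (x + (-1 / 2))]
        · rw [show x + (-1 / 2) + 1 = x + 1 / 2 by ring, ← setLIntegral_Ioc_comp_add_left]
          refine setLIntegral_congr_fun measurableSet_Ioc fun h hh => ?_
          rw [edist_coe_add hh, ← enorm_neg, neg_sub]
        · intro y
          simp only [hper y, hcoe]
    _ = ∫⁻ h in Ioc (-1 / 2 : ℝ) (1 / 2), ∫⁻ x in Ioc (0 : ℝ) 1, 
      ‖g (x + h) - g x‖ₑ ^ p / ‖h‖ₑ ^ (1 + σ * p) := by
        apply lintegral_lintegral_swap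
        apply Measurable.aemeasurable
        have : Measurable (fun q : ℝ × ℝ => ‖g (q.1 + q.2) - g q.1‖ₑ) := by
          apply Continuous.measurable
          fun_prop
        have h2 : Measurable (fun q : ℝ × ℝ => ‖q.2‖ₑ) := by
          apply Continuous.measurable
          fun_prop
        exact (this.pow_const p).div (h2.pow_const _)
    _ = _ := by
        congr 1
        ext h
        simp_rw [div_eq_mul_inv]
        rw [lintegral_mul_const]
        have : Measurable (fun x : ℝ => ‖g (x + h) - g x‖ₑ) := by
          apply Continuous.measurable
          fun_prop
        exact this.pow_const p

/-- The integral of `|h| ^ r` over `(-1/2, 1/2]`. -/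
def rpowIntegral (r : ℝ) : ℝ≥0∞ := ∫⁻ h in Ioc (-1 / 2 : ℝ) (1 / 2), ‖h‖ₑ ^ r

lemma setLIntegral_enorm_rpow_lt_top {r : ℝ} (hr : -1 < r) (b : ℝ) (hb : 0 ≤ b) :
    ∫⁻ h in Ioc (0 : ℝ) b, ‖h‖ₑ ^ r < ⊤ := by
  have h1 := (intervalIntegral.intervalIntegrable_rpow' (a := 0) (b := b) hr)
  rw [intervalIntegrable_iff_integrableOn_Ioc_of_le hb] at h1
  refine lt_of_le_of_lt (le_of_eq ?_) h1.2
  refine setLIntegral_congr_fun measurableSet_Ioc fun h hh => ?_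
  simp only
  rw [Real.enorm_eq_ofReal hh.1.le, Real.enorm_eq_ofReal (Real.rpow_nonneg hh.1.le _),
    ENNReal.ofReal_rpow_of_pos hh.1]

lemma rpowIntegral_lt_top {r : ℝ} (hr : -1 < r) : rpowIntegral r < ⊤ := by
  have h1 := setLIntegral_enorm_rpow_lt_top hr (1 / 2) (by norm_num)
  have h2 : ∫⁻ h in Ioc (-1 / 2 : ℝ) 0, ‖h‖ₑ ^ r = ∫⁻ h in Ioc (0 : ℝ) (1 / 2), ‖h‖ₑ ^ r := by
    have h := (Measure.measurePreserving_neg (volume : Measure ℝ)).setLIntegral_comp_preimage_emb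
      (MeasurableEquiv.neg ℝ).measurableEmbedding (fun h => ‖h‖ₑ ^ r) (Ico (0 : ℝ) (1 / 2))
    simp only [enorm_neg] at h
    rw [← restrict_Ico_eq_restrict_Ioc (a := (0 : ℝ)), ← h]
    simp [neg_div]
  have h3 : Ioc (-1 / 2 : ℝ) (1 / 2) = Ioc (-1 / 2 : ℝ) 0 ∪ Ioc (0 : ℝ) (1 / 2) :=
    (Ioc_union_Ioc_eq_Ioc (by norm_num) (by norm_num)).symm
  rw [rpowIntegral, h3]
  refine (lintegral_union_le _ _ _).trans_lt ?_
  rw [h2]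
  exact ENNReal.add_lt_top.2 ⟨h1, h1⟩

/-- Reduces the seminorm to an `L^p` modulus of continuity; the bound is finite for finite `B` once
`γ > σ p`, by `rpowIntegral_lt_top`. -/
lemma gagliardo_le {g : ℝ → ℝ} (hg : Continuous g) (hper : Function.Periodic g 1)
    {σ p γ : ℝ} (hp : 0 < p) {B : ℝ≥0∞}
    (hB : ∀ h, h ∈ Ioc (-1 / 2 : ℝ) (1 / 2) →
      ∫⁻ x in Ioc (0 : ℝ) 1, ‖g (x + h) - g x‖ₑ ^ p ≤ B * ‖h‖ₑ ^ γ) :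
    gagliardo σ p g ≤ (B * rpowIntegral (γ - (1 + σ * p))) ^ (1 / p) := by
  rw [gagliardo, gagliardo_lintegral_eq hg hper]
  gcongr
  rw [rpowIntegral, ← lintegral_const_mul _ ((by fun_prop : Measurable (fun h : ℝ => ‖h‖ₑ)).pow_const _)]
  refine lintegral_mono_ae ?_
  have h0 : ∀ᵐ h ∂(volume.restrict (Ioc (-1 / 2 : ℝ) (1 / 2))), h ≠ (0 : ℝ) :=
    ae_restrict_of_ae (Measure.ae_ne volume 0)
  filter_upwards [ae_restrict_mem measurableSet_Ioc, h0] with h hh hne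
  have hne' : ‖h‖ₑ ≠ 0 := by simpa using hne
  rw [ENNReal.rpow_sub _ _ hne' enorm_ne_top, ← mul_div_assoc]
  exact ENNReal.div_le_div_right (hB h hh) _

/-! ### Vector fields with large derivatives but bounded total variation -/

/-- The interpolation step: it trades a bound proportional to `M |h|` against one independent of `M`
and `h`. -/
lemma le_rpow_mul_rpow {a X Y : ℝ≥0∞} {θ : ℝ} (h0 : 0 ≤ θ) (h1 : θ ≤ 1) (hX : a ≤ X)
    (hY : a ≤ Y) : a ≤ X ^ θ * Y ^ (1 - θ) := by
  calc a = a ^ θ * a ^ (1 - θ) := by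
        rw [← ENNReal.rpow_add_of_nonneg _ _ h0 (sub_nonneg.2 h1)]
        simp
    _ ≤ _ := mul_le_mul' (ENNReal.rpow_le_rpow hX h0) (ENNReal.rpow_le_rpow hY (sub_nonneg.2 h1))

lemma rpow_le_rpow_sub_one_mul {a X : ℝ≥0∞} {p : ℝ} (hp : 1 ≤ p) (hX : a ≤ X) :
    a ^ p ≤ X ^ (p - 1) * a := by
  calc a ^ p = a ^ (p - 1) * a ^ (1 : ℝ) := by
        rw [← ENNReal.rpow_add_of_nonneg _ _ (by linarith) zero_le_one]
        simp
    _ ≤ _ := by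
        rw [ENNReal.rpow_one]
        exact mul_le_mul' (ENNReal.rpow_le_rpow hX (by linarith)) le_rfl

/-- A periodic vector field bounded by `1` whose derivative is bounded by `M`, has
`L¹`-norm at most `2` and total variation at most `4 M`. -/
structure Controlled (M : ℝ) (v : ℝ → ℝ) : Prop where
  smooth : ContDiff ℝ ∞ v
  periodic : Function.Periodic v 1
  abs_le : ∀ x, |v x| ≤ 1
  abs_deriv_le : ∀ x, |deriv v x| ≤ M
  deriv_integral_le : ∫⁻ x in Ioc (0 : ℝ) 1, ‖deriv v x‖ₑ ≤ 2
  variation_le : ∫⁻ x in Ioc (0 : ℝ) 1, ‖deriv (deriv v) x‖ₑ ≤ 4 * ENNReal.ofReal M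

/-- The functional `X` grows sublinearly in `M` on the vector fields controlled by `M`. -/
def SublinearOnControlled (X : (ℝ → ℝ) → ℝ≥0∞) : Prop :=
  ∃ C : ℝ≥0, ∃ θ : ℝ, θ < 1 ∧ ∀ M : ℝ, 1 ≤ M → ∀ v, Controlled M v →
    X v ≤ C * ENNReal.ofReal M ^ θ

lemma SublinearOnControlled.add {X Y : (ℝ → ℝ) → ℝ≥0∞} (hX : SublinearOnControlled X)
    (hY : SublinearOnControlled Y) : SublinearOnControlled (fun v => X v + Y v) := by
  obtain ⟨C, θ, h1, hC⟩ := hX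
  obtain ⟨D, η, h2, hD⟩ := hY
  refine ⟨C + D, max θ η, max_lt h1 h2, fun M hM v hv => ?_⟩
  have hm : (1 : ℝ≥0∞) ≤ ENNReal.ofReal M := by simpa using hM
  rw [ENNReal.coe_add, add_mul]
  refine add_le_add ((hC M hM v hv).trans ?_) ((hD M hM v hv).trans ?_)
  · gcongr
    exact le_max_left _ _
  · gcongr
    exact le_max_right _ _

lemma sublinearOnControlled_of_le {X : (ℝ → ℝ) → ℝ≥0∞} {c : ℝ≥0∞} (hc : c ≠ ⊤) {η p : ℝ}
    (hp : 0 < p) (hη : η < p)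
    (h : ∀ M : ℝ, 1 ≤ M → ∀ v, Controlled M v → X v ≤ (ENNReal.ofReal M ^ η * c) ^ (1 / p)) :
    SublinearOnControlled X := by
  refine ⟨(c ^ (1 / p)).toNNReal, η / p, (div_lt_one hp).2 hη, fun M hM v hv => ?_⟩
  have hpp : 0 ≤ 1 / p := by positivity
  rw [ENNReal.coe_toNNReal (ENNReal.rpow_ne_top_of_nonneg hpp hc)]
  refine (h M hM v hv).trans (le_of_eq ?_)
  rw [ENNReal.mul_rpow_of_nonneg _ _ hpp, ← ENNReal.rpow_mul, mul_one_div, mul_comm]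

lemma enorm_le_of_abs_le {a M : ℝ} (h : |a| ≤ M) : ‖a‖ₑ ≤ ENNReal.ofReal M := by
  rw [← ofReal_norm]
  exact ENNReal.ofReal_le_ofReal h

/-! ### Sublinear growth of the individual terms of the Sobolev norm -/

lemma sublinearOnControlled_eLpNorm (p : ℝ) :
    SublinearOnControlled (fun v => eLpNorm v (ENNReal.ofReal p)
      (volume.restrict (Ioc (0 : ℝ) 1))) := by
  refine ⟨1, 0, zero_lt_one, fun M _ v hv => ?_⟩
  refine (eLpNorm_le_of_ae_bound (C := 1) (ae_of_all _ hv.abs_le)).trans ?_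
  simp

lemma eLpNorm_ofReal_eq {p : ℝ} (hp : 1 ≤ p) (f : ℝ → ℝ) (μ : Measure ℝ) :
    eLpNorm f (ENNReal.ofReal p) μ = (∫⁻ x, ‖f x‖ₑ ^ p ∂μ) ^ (1 / p) := by
  have hp0 : 0 < p := by linarith
  rw [eLpNorm_eq_lintegral_rpow_enorm_toReal (by simpa using hp0) ENNReal.ofReal_ne_top,
    ENNReal.toReal_ofReal hp0.le]

lemma sublinearOnControlled_eLpNorm_deriv {p : ℝ} (hp : 1 ≤ p) :
    SublinearOnControlled (fun v => eLpNorm (deriv v) (ENNReal.ofReal p)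
      (volume.restrict (Ioc (0 : ℝ) 1))) := by
  have hp0 : 0 < p := by linarith
  refine sublinearOnControlled_of_le (c := 2) (by simp) hp0 (show p - 1 < p by linarith)
    fun M _ v hv => ?_
  rw [eLpNorm_ofReal_eq hp]
  gcongr
  calc ∫⁻ x in Ioc (0 : ℝ) 1, ‖deriv v x‖ₑ ^ p
      ≤ ∫⁻ x in Ioc (0 : ℝ) 1, ENNReal.ofReal M ^ (p - 1) * ‖deriv v x‖ₑ :=
        lintegral_mono fun x =>
          rpow_le_rpow_sub_one_mul hp (enorm_le_of_abs_le (hv.abs_deriv_le x))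
    _ = ENNReal.ofReal M ^ (p - 1) * ∫⁻ x in Ioc (0 : ℝ) 1, ‖deriv v x‖ₑ :=
        lintegral_const_mul' _ _ (ENNReal.rpow_ne_top_of_nonneg (by linarith) ENNReal.ofReal_ne_top)
    _ ≤ _ := by
        gcongr
        exact hv.deriv_integral_le

lemma enorm_sub_le_add {a b : ℝ} {m : ℝ≥0∞} (ha : ‖a‖ₑ ≤ m) (hb : ‖b‖ₑ ≤ m) :
    ‖a - b‖ₑ ≤ 2 * m := by
  rw [two_mul]
  exact enorm_sub_le.trans (add_le_add ha hb)

lemma sublinearOnControlled_gagliardo {σ p : ℝ} (hp : 1 ≤ p) (h0 : 0 < σ) (h1 : σ < 1) :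
    SublinearOnControlled (fun v => gagliardo σ p v) := by
  have hp0 : 0 < p := by linarith
  -- `θ > σ` makes the integral over `h` converge at `0`, and `θ < 1` keeps the growth in `M`
  -- sublinear.
  obtain ⟨θ, hσθ, hθ1⟩ := exists_between h1
  have hθ0 : 0 ≤ θ := by linarith
  have hr : rpowIntegral (θ * p - (1 + σ * p)) < ⊤ :=
    rpowIntegral_lt_top (by nlinarith)
  have hc : ((2 : ℝ≥0∞) ^ (1 - θ)) ^ p ≠ ⊤ :=
    ENNReal.rpow_ne_top_of_nonneg hp0.le
      (ENNReal.rpow_ne_top_of_nonneg (by linarith) (by simp))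
  refine sublinearOnControlled_of_le
    (c := ((2 : ℝ≥0∞) ^ (1 - θ)) ^ p * rpowIntegral (θ * p - (1 + σ * p)))
    (ENNReal.mul_ne_top hc hr.ne) hp0 (show θ * p < p by nlinarith) fun M hM v hv => ?_
  rw [← mul_assoc]
  refine gagliardo_le hv.smooth.continuous hv.periodic hp0 fun h _ => ?_
  have hpt : ∀ x, ‖v (x + h) - v x‖ₑ ≤ (ENNReal.ofReal M * ‖h‖ₑ) ^ θ * 2 ^ (1 - θ) := fun x => by
    refine le_rpow_mul_rpow hθ0 hθ1.le ?_ ?_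
    · have := Convex.norm_image_sub_le_of_norm_deriv_le (𝕜 := ℝ) (f := v) (s := univ) (C := M)
        (fun y _ => (hv.smooth.differentiable (by simp)) y) (fun y _ => hv.abs_deriv_le y)
        convex_univ (mem_univ x) (mem_univ (x + h))
      rw [add_sub_cancel_left] at this
      rw [← ofReal_norm, ← ofReal_norm, ← ENNReal.ofReal_mul (by linarith)]
      exact ENNReal.ofReal_le_ofReal this
    · have := enorm_sub_le_add (enorm_le_of_abs_le (hv.abs_le (x + h)))
        (enorm_le_of_abs_le (hv.abs_le x))
      simpa using this
  calc ∫⁻ x in Ioc (0 : ℝ) 1, ‖v (x + h) - v x‖ₑ ^ p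
      ≤ ∫⁻ x in Ioc (0 : ℝ) 1, ((ENNReal.ofReal M * ‖h‖ₑ) ^ θ * 2 ^ (1 - θ)) ^ p :=
        lintegral_mono fun x => ENNReal.rpow_le_rpow (hpt x) hp0.le
    _ = _ := by
        rw [lintegral_const, Measure.restrict_apply_univ, Real.volume_Ioc]
        simp only [sub_zero, ENNReal.ofReal_one, mul_one]
        rw [ENNReal.mul_rpow_of_nonneg _ _ hp0.le, ENNReal.mul_rpow_of_nonneg _ _ hθ0,
          ENNReal.mul_rpow_of_nonneg _ _ hp0.le, ← ENNReal.rpow_mul, ← ENNReal.rpow_mul]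
        ring

/-- The sup bound on `v'` reduces the `p`-th power of a difference to `M ^ (p - 1)` times its `L¹`
norm. The latter is at most `4 M |h|` by total variation and at most `4` trivially. Interpolation
with weight `γ < 1` yields total exponent `(p - 1 + γ) / p < 1`; the requirement `γ > σ p` is where
subcriticality enters. -/
lemma sublinearOnControlled_gagliardo_deriv {σ p : ℝ} (hp : 1 ≤ p) (h0 : 0 < σ)
    (h1 : σ < 1 / p) : SublinearOnControlled (fun v => gagliardo σ p (deriv v)) := by
  have hp0 : 0 < p := by linarith
  have hσp : σ * p < 1 := (lt_div_iff₀ hp0).1 h1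
  obtain ⟨γ, hσγ, hγ1⟩ := exists_between hσp
  have hγ0 : 0 ≤ γ := by nlinarith
  have hr : rpowIntegral (γ - (1 + σ * p)) < ⊤ := rpowIntegral_lt_top (by linarith)
  have hc : ((2 : ℝ≥0∞) ^ (p - 1)) * (4 ^ γ * 4 ^ (1 - γ)) ≠ ⊤ :=
    ENNReal.mul_ne_top (ENNReal.rpow_ne_top_of_nonneg (by linarith) (by simp))
      (ENNReal.mul_ne_top (ENNReal.rpow_ne_top_of_nonneg hγ0 (by simp))
        (ENNReal.rpow_ne_top_of_nonneg (by linarith) (by simp)))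
  refine sublinearOnControlled_of_le
    (c := ((2 : ℝ≥0∞) ^ (p - 1)) * (4 ^ γ * 4 ^ (1 - γ)) * rpowIntegral (γ - (1 + σ * p)))
    (ENNReal.mul_ne_top hc hr.ne) hp0 (show p - 1 + γ < p by linarith) fun M hM v hv => ?_
  have hper := periodic_deriv hv.periodic
  have hsm : ContDiff ℝ 1 (deriv v) :=
    ((contDiff_infty_iff_deriv.1 hv.smooth).2).of_le (by exact_mod_cast le_top)
  have hcont : Continuous (deriv v) := hsm.continuous
  rw [← mul_assoc]
  refine gagliardo_le hcont hper hp0 fun h _ => ?_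
  have hfin : (2 * ENNReal.ofReal M) ^ (p - 1) ≠ ⊤ :=
    ENNReal.rpow_ne_top_of_nonneg (by linarith) (ENNReal.mul_ne_top (by simp) ENNReal.ofReal_ne_top)
  have hL1 : ∫⁻ x in Ioc (0 : ℝ) 1, ‖deriv v (x + h) - deriv v x‖ₑ ≤
      (4 * ENNReal.ofReal M * ‖h‖ₑ) ^ γ * 4 ^ (1 - γ) := by
    refine le_rpow_mul_rpow hγ0 hγ1.le ?_ ?_
    · refine (lintegral_enorm_shift_sub_le hsm hper h).trans ?_
      rw [mul_comm]
      gcongr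
      exact hv.variation_le
    · have hP : Function.Periodic (fun x => ‖deriv v x‖ₑ) 1 := fun x => by simp only [hper x]
      calc ∫⁻ x in Ioc (0 : ℝ) 1, ‖deriv v (x + h) - deriv v x‖ₑ
          ≤ ∫⁻ x in Ioc (0 : ℝ) 1, (‖deriv v (x + h)‖ₑ + ‖deriv v x‖ₑ) :=
            lintegral_mono fun x => enorm_sub_le
        _ = (∫⁻ x in Ioc (0 : ℝ) 1, ‖deriv v (x + h)‖ₑ) +
              ∫⁻ x in Ioc (0 : ℝ) 1, ‖deriv v x‖ₑ :=
            lintegral_add_right _ (by fun_prop)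
        _ ≤ 2 + 2 := by
            rw [setLIntegral_Ioc_periodic_shift hP h]
            exact add_le_add hv.deriv_integral_le hv.deriv_integral_le
        _ = 4 := by norm_num
  calc ∫⁻ x in Ioc (0 : ℝ) 1, ‖deriv v (x + h) - deriv v x‖ₑ ^ p
      ≤ ∫⁻ x in Ioc (0 : ℝ) 1, (2 * ENNReal.ofReal M) ^ (p - 1) *
          ‖deriv v (x + h) - deriv v x‖ₑ :=
        lintegral_mono fun x => rpow_le_rpow_sub_one_mul hp
          (enorm_sub_le_add (enorm_le_of_abs_le (hv.abs_deriv_le _))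
            (enorm_le_of_abs_le (hv.abs_deriv_le _)))
    _ = (2 * ENNReal.ofReal M) ^ (p - 1) *
          ∫⁻ x in Ioc (0 : ℝ) 1, ‖deriv v (x + h) - deriv v x‖ₑ := lintegral_const_mul' _ _ hfin
    _ ≤ (2 * ENNReal.ofReal M) ^ (p - 1) * ((4 * ENNReal.ofReal M * ‖h‖ₑ) ^ γ * 4 ^ (1 - γ)) := by
        gcongr
    _ = _ := by
        rw [ENNReal.mul_rpow_of_nonneg _ _ hγ0, ENNReal.mul_rpow_of_nonneg _ _ hγ0,
          ENNReal.mul_rpow_of_nonneg _ _ (by linarith : 0 ≤ p - 1),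
          ENNReal.rpow_add_of_nonneg _ _ (by linarith : 0 ≤ p - 1) hγ0]
        ring

/-- Below the critical exponent `1 + 1 / p` the Sobolev norm grows sublinearly in the bound for the
derivative. -/
theorem sublinearOnControlled_sobolevNorm {s p : ℝ} (hs : 0 ≤ s) (hp : 1 ≤ p)
    (hsp : s < 1 + 1 / p) : SublinearOnControlled (sobolevNorm s p) := by
  have hp0 : 0 < p := by linarith
  have hp1 : 1 / p ≤ 1 := (div_le_one hp0).2 hp
  have hk : ⌊s⌋₊ < 2 := (Nat.floor_lt hs).2 (by push_cast; linarith)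
  have hzero : SublinearOnControlled (fun _ => 0) := ⟨0, 0, zero_lt_one, fun _ _ _ _ => by simp⟩
  have hle : (⌊s⌋₊ : ℝ) ≤ s := Nat.floor_le hs
  unfold sobolevNorm intSobolevNorm
  rcases (by omega : ⌊s⌋₊ = 0 ∨ ⌊s⌋₊ = 1) with h | h
  · have hs1 : s < 1 := by
      have := Nat.lt_floor_add_one s
      rw [h] at this
      simpa using this
    simp only [h, zero_add, Finset.range_one, Finset.sum_singleton, iteratedDeriv_zero,
      Nat.cast_zero, sub_zero]
    refine (sublinearOnControlled_eLpNorm p).add ?_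
    split_ifs with h0
    · exact hzero
    · exact sublinearOnControlled_gagliardo hp (lt_of_le_of_ne hs (Ne.symm h0)) hs1
  · rw [h] at hle
    simp only [h, Finset.sum_range_succ, Finset.range_zero, Finset.sum_empty, zero_add,
      iteratedDeriv_zero, iteratedDeriv_one, Nat.cast_one] at hle ⊢
    refine ((sublinearOnControlled_eLpNorm p).add (sublinearOnControlled_eLpNorm_deriv hp)).add ?_
    split_ifs with h0
    · exact hzero
    · exact sublinearOnControlled_gagliardo_deriv hp
        (sub_pos.2 (lt_of_le_of_ne hle (Ne.symm h0))) (by linarith)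

/-! ### Lifts of diffeomorphisms and velocities of paths -/

namespace IsDiffeoLift

variable {F : ℝ → ℝ}

lemma strictMono (hF : IsDiffeoLift F) : StrictMono F := strictMono_of_deriv_pos hF.deriv_pos

lemma add_int (hF : IsDiffeoLift F) (x : ℝ) (n : ℤ) : F (x + n) = F x + n := by
  have hper : Function.Periodic (fun x => F x - x) 1 := fun x => by
    simp only [hF.add_one]
    ring
  have := hper.int_mul n x
  simp only [mul_one] at this
  linarith

lemma surjective (hF : IsDiffeoLift F) : Function.Surjective F := by
  intro y
  obtain ⟨m, hm⟩ := exists_int_lt (y - F 0)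
  obtain ⟨n, hn⟩ := exists_int_gt (y - F 0)
  have h1 := hF.add_int 0 m
  have h2 := hF.add_int 0 n
  rw [zero_add] at h1 h2
  have hmn : (m : ℝ) ≤ n := by linarith
  obtain ⟨x, -, hx⟩ := intermediate_value_Icc hmn hF.smooth.continuous.continuousOn
    (show y ∈ Icc (F m) (F n) from ⟨by linarith, by linarith⟩)
  exact ⟨x, hx⟩

lemma invFun_apply (hF : IsDiffeoLift F) (x : ℝ) : Function.invFun F (F x) = x :=
  Function.leftInverse_invFun hF.strictMono.injective x

lemma apply_invFun (hF : IsDiffeoLift F) (y : ℝ) : F (Function.invFun F y) = y :=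
  Function.rightInverse_invFun hF.surjective y

lemma contDiff_invFun (hF : IsDiffeoLift F) : ContDiff ℝ ∞ (Function.invFun F) := by
  let e : ℝ ≃ₜ ℝ := (hF.strictMono.orderIsoOfSurjective F hF.surjective).toHomeomorph
  have he : ∀ x, e x = F x := fun x => rfl
  have hes : ∀ y, e.symm y = Function.invFun F y := fun y => by
    rw [e.symm_apply_eq, he, hF.apply_invFun]
  rw [← funext hes]
  exact e.contDiff_symm_deriv (f' := deriv F) (fun x => (hF.deriv_pos x).ne')
    (fun x => (hF.smooth.differentiable (by simp) x).hasDerivAt) hF.smooth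

lemma invFun_add_one (hF : IsDiffeoLift F) (y : ℝ) :
    Function.invFun F (y + 1) = Function.invFun F y + 1 := by
  apply hF.strictMono.injective
  rw [hF.apply_invFun, hF.add_one, hF.apply_invFun]

end IsDiffeoLift

lemma contDiff_slice {Φ : ℝ → ℝ → ℝ} (h : ContDiff ℝ ∞ (fun q : ℝ × ℝ => Φ q.1 q.2)) (x : ℝ) :
    ContDiff ℝ ∞ (fun t => Φ t x) :=
  h.comp (contDiff_id.prodMk contDiff_const)

lemma contDiff_deriv_time {Φ : ℝ → ℝ → ℝ} (h : ContDiff ℝ ∞ (fun q : ℝ × ℝ => Φ q.1 q.2))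
    (t : ℝ) : ContDiff ℝ ∞ (fun x => deriv (fun τ => Φ τ x) t) := by
  have h1 : ∀ x, deriv (fun τ => Φ τ x) t =
      fderiv ℝ (fun q : ℝ × ℝ => Φ q.1 q.2) (t, x) (1, 0) := fun x => by
    have hf := (h.differentiable (by simp) (t, x)).hasFDerivAt
    have hg : HasDerivAt (fun τ : ℝ => (τ, x)) ((1 : ℝ), (0 : ℝ)) t :=
      (hasDerivAt_id t).prodMk (hasDerivAt_const t x)
    exact (hf.comp_hasDerivAt t hg).deriv
  rw [funext h1]
  have h2 : ContDiff ℝ ∞ (fderiv ℝ (fun q : ℝ × ℝ => Φ q.1 q.2)) :=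
    h.fderiv_right (by simp)
  exact (h2.comp (contDiff_const.prodMk contDiff_id)).clm_apply contDiff_const

namespace IsPath

variable {Φ : ℝ → ℝ → ℝ} {φ₀ φ₁ : Diffeo} {t : ℝ}

lemma velocity_apply (h : IsPath Φ φ₀ φ₁) (ht : t ∈ Icc (0 : ℝ) 1) (x : ℝ) :
    velocity Φ t (Φ t x) = deriv (fun τ => Φ τ x) t := by
  rw [velocity, (h.diffeo t ht).invFun_apply]

lemma contDiff_velocity (h : IsPath Φ φ₀ φ₁) (ht : t ∈ Icc (0 : ℝ) 1) :
    ContDiff ℝ ∞ (velocity Φ t) :=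
  (contDiff_deriv_time h.smooth t).comp (h.diffeo t ht).contDiff_invFun

/-- The periodicity of the velocity also holds at the end points of the time interval, where the
time derivative is determined by times inside the interval. -/
lemma periodic_velocity (h : IsPath Φ φ₀ φ₁) (ht : t ∈ Icc (0 : ℝ) 1) :
    Function.Periodic (velocity Φ t) 1 := by
  intro y
  have hd : ∀ z, HasDerivWithinAt (fun τ => Φ τ z) (deriv (fun τ => Φ τ z) t) (Icc 0 1) t :=
    fun z => ((contDiff_slice h.smooth z).differentiable (by simp) t).hasDerivAt.hasDerivWithinAt
  rw [velocity, velocity, (h.diffeo t ht).invFun_add_one]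
  set x := Function.invFun (Φ t) y
  have h1 := hd (x + 1)
  have h2 := (hd x).add_const 1
  have h3 : HasDerivWithinAt (fun τ => Φ τ (x + 1)) (deriv (fun τ => Φ τ x) t) (Icc 0 1) t :=
    h2.congr (fun τ hτ => (h.diffeo τ hτ).add_one x) ((h.diffeo t ht).add_one x)
  exact (uniqueDiffOn_Icc zero_lt_one).uniqueDiffWithinAt ht |>.eq_deriv _ h1 h3

end IsPath

/-! ### Affine paths -/

/-- The affine path from the identity to `F`. -/
def affinePath (F : ℝ → ℝ) (t x : ℝ) : ℝ := x + t * (F x - x)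

lemma IsDiffeoLift.periodic_coe {F : ℝ → ℝ} (hF : IsDiffeoLift F) :
    Function.Periodic (fun x => (F x : UnitAddCircle)) 1 := fun x => by
  simp [hF.add_one]

/-- The diffeomorphism of the circle with lift `F`. -/
def IsDiffeoLift.toDiffeo {F : ℝ → ℝ} (hF : IsDiffeoLift F) : Diffeo where
  toFun := hF.periodic_coe.lift
  exists_lift := ⟨F, hF, fun x => hF.periodic_coe.lift_coe x⟩

lemma IsDiffeoLift.toDiffeo_apply {F : ℝ → ℝ} (hF : IsDiffeoLift F) (x : ℝ) :
    hF.toDiffeo.toFun (x : UnitAddCircle) = (F x : ℝ) :=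
  hF.periodic_coe.lift_coe x

lemma hasDerivAt_affinePath {F : ℝ → ℝ} (hF : IsDiffeoLift F) (t x : ℝ) :
    HasDerivAt (affinePath F t) (1 + t * (deriv F x - 1)) x := by
  have h := (hF.smooth.differentiable (by simp) x).hasDerivAt
  exact (hasDerivAt_id x).add (((h.sub (hasDerivAt_id x))).const_mul t)

/-- The expression is a convex combination of `1` and `q`, so affine paths stay among the
diffeomorphisms. -/
lemma one_add_mul_pos {t q : ℝ} (ht : t ∈ Icc (0 : ℝ) 1) (hq : 0 < q) : 0 < 1 + t * (q - 1) := by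
  rcases ht.1.eq_or_lt with h | h
  · simp [← h]
  · nlinarith [ht.2, mul_pos h hq]

lemma isDiffeoLift_affinePath {F : ℝ → ℝ} (hF : IsDiffeoLift F) {t : ℝ}
    (ht : t ∈ Icc (0 : ℝ) 1) : IsDiffeoLift (affinePath F t) where
  smooth := contDiff_id.add (contDiff_const.mul (hF.smooth.sub contDiff_id))
  add_one x := by
    rw [affinePath, affinePath, hF.add_one]
    ring
  deriv_pos x := by
    rw [(hasDerivAt_affinePath hF t x).deriv]
    exact one_add_mul_pos ht (hF.deriv_pos x)

lemma isPath_affinePath {F : ℝ → ℝ} (hF : IsDiffeoLift F) :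
    IsPath (affinePath F) Diffeo.id hF.toDiffeo where
  smooth := by
    have := hF.smooth
    unfold affinePath
    fun_prop
  diffeo t ht := isDiffeoLift_affinePath hF ht
  source x := by simp [affinePath, Diffeo.id]
  target x := by simp [affinePath, hF.toDiffeo_apply]

lemma velocity_affinePath {F : ℝ → ℝ} (hF : IsDiffeoLift F) {t : ℝ}
    (ht : t ∈ Icc (0 : ℝ) 1) (x : ℝ) :
    velocity (affinePath F) t (affinePath F t x) = F x - x := by
  rw [(isPath_affinePath hF).velocity_apply ht]
  have := ((hasDerivAt_id t).mul_const (F x - x)).const_add x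
  exact this.deriv.trans (one_mul _)

/-! ### Total variation of monotone and unimodal functions -/

lemma lintegral_enorm_deriv_eq_of_nonneg {g : ℝ → ℝ} (hg : ContDiff ℝ 1 g) {a b : ℝ}
    (hab : a ≤ b) (h : ∀ x ∈ Ioo a b, 0 ≤ deriv g x) :
    ∫⁻ x in Ioc a b, ‖deriv g x‖ₑ = ENNReal.ofReal (g b - g a) := by
  have hc : Continuous (deriv g) := hg.continuous_deriv le_rfl
  have h1 := intervalIntegral.integral_eq_sub_of_hasDerivAt (a := a) (b := b)
    (fun s _ => (hg.differentiable one_ne_zero s).hasDerivAt) (hc.intervalIntegrable _ _)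
  have hnn : ∀ᵐ x ∂(volume.restrict (Ioc a b)), 0 ≤ deriv g x := by
    rw [← restrict_Ioo_eq_restrict_Ioc]
    exact (ae_restrict_mem measurableSet_Ioo).mono h
  rw [← h1, intervalIntegral.integral_of_le hab,
    ofReal_integral_eq_lintegral_ofReal (hc.integrableOn_Ioc) hnn]
  exact lintegral_congr_ae (hnn.mono fun x hx => Real.enorm_eq_ofReal hx)

lemma lintegral_enorm_deriv_eq_of_monotoneOn {g : ℝ → ℝ} (hg : ContDiff ℝ 1 g) {a b : ℝ}
    (hab : a ≤ b) (h : MonotoneOn g (Icc a b)) :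
    ∫⁻ x in Ioc a b, ‖deriv g x‖ₑ = ENNReal.ofReal (g b - g a) := by
  refine lintegral_enorm_deriv_eq_of_nonneg hg hab fun x hx => ?_
  have h1 := h.derivWithin_nonneg (x := x)
  rwa [derivWithin_of_mem_nhds (Icc_mem_nhds hx.1 hx.2)] at h1

lemma lintegral_enorm_deriv_eq_of_antitoneOn {g : ℝ → ℝ} (hg : ContDiff ℝ 1 g) {a b : ℝ}
    (hab : a ≤ b) (h : AntitoneOn g (Icc a b)) :
    ∫⁻ x in Ioc a b, ‖deriv g x‖ₑ = ENNReal.ofReal (g a - g b) := by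
  have h1 := lintegral_enorm_deriv_eq_of_monotoneOn hg.neg hab
    (g := fun x => - g x) (fun x hx y hy hxy => neg_le_neg (h hx hy hxy))
  rw [show g a - g b = -g b - -g a by ring, ← h1]
  simp

/-- The total variation of a periodic function that first increases and then decreases. -/
lemma lintegral_enorm_deriv_le_of_unimodal {g : ℝ → ℝ} (hg : ContDiff ℝ 1 g)
    (hper : Function.Periodic g 1) {a b M : ℝ} (hab : a ≤ b) (hba : b ≤ a + 1)
    (hmono : MonotoneOn g (Icc a b)) (hanti : AntitoneOn g (Icc b (a + 1)))
    (hM : ∀ x, |g x| ≤ M) :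
    ∫⁻ x in Ioc (0 : ℝ) 1, ‖deriv g x‖ₑ ≤ 4 * ENNReal.ofReal M := by
  have hp : Function.Periodic (fun x => ‖deriv g x‖ₑ) 1 := fun x => by
    simp only [periodic_deriv hper x]
  have h2M : ∀ x y, ENNReal.ofReal (g x - g y) ≤ 2 * ENNReal.ofReal M := fun x y => by
    rw [show (2 : ℝ≥0∞) = ENNReal.ofReal 2 by simp, ← ENNReal.ofReal_mul (by norm_num)]
    apply ENNReal.ofReal_le_ofReal
    have h1 := abs_le.1 (hM x)
    have h2 := abs_le.1 (hM y)
    linarith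
  rw [← setLIntegral_Ioc_add_one hp a, ← Ioc_union_Ioc_eq_Ioc hab hba]
  refine (lintegral_union_le _ _ _).trans ?_
  rw [lintegral_enorm_deriv_eq_of_monotoneOn hg hab hmono,
    lintegral_enorm_deriv_eq_of_antitoneOn hg hba hanti]
  refine (add_le_add (h2M _ _) (h2M _ _)).trans (le_of_eq ?_)
  rw [← add_mul]
  norm_num

/-! ### Uniform bounds for velocities of affine paths -/

section AffinePath

variable {F : ℝ → ℝ} {t : ℝ}

/-- Differentiate the identity `velocity ∘ affinePath = F - id` in `x`. -/
lemma deriv_velocity_affinePath (hF : IsDiffeoLift F) (ht : t ∈ Icc (0 : ℝ) 1) (x : ℝ) :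
    deriv (velocity (affinePath F) t) (affinePath F t x) =
      (deriv F x - 1) / (1 + t * (deriv F x - 1)) := by
  have hv := ((isPath_affinePath hF).contDiff_velocity ht).differentiable (by simp)
    (affinePath F t x)
  have h1 := hv.hasDerivAt.comp x (hasDerivAt_affinePath hF t x)
  have h2 : (velocity (affinePath F) t) ∘ (affinePath F t) = fun x => F x - x :=
    funext fun x => velocity_affinePath hF ht x
  rw [h2] at h1
  have h3 := ((hF.smooth.differentiable (by simp) x).hasDerivAt.sub (hasDerivAt_id x))
  rw [eq_div_iff (one_add_mul_pos ht (hF.deriv_pos x)).ne']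
  exact h1.unique h3

/-- This monotonicity carries unimodality from `deriv F` to the derivative of the velocity. -/
lemma div_one_add_mul_mono (ht : t ∈ Icc (0 : ℝ) 1) {q r : ℝ} (hq : 0 < q) (hqr : q ≤ r) :
    (q - 1) / (1 + t * (q - 1)) ≤ (r - 1) / (1 + t * (r - 1)) := by
  rw [div_le_div_iff₀ (one_add_mul_pos ht hq) (one_add_mul_pos ht (hq.trans_le hqr))]
  nlinarith

/-- The limits of the increasing quotient at `q = 0` and `q = ∞` are `-1/(1-t)` and `1/t`; the sum
of their absolute values is a convenient common bound. -/
lemma abs_div_one_add_mul_le (ht : t ∈ Ioo (0 : ℝ) 1) {q : ℝ} (hq : 0 < q) :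
    |(q - 1) / (1 + t * (q - 1))| ≤ 1 / t + 1 / (1 - t) := by
  have hpos := one_add_mul_pos (Ioo_subset_Icc_self ht) hq
  have h0 := ht.1
  have h1 : 0 < 1 - t := sub_pos.2 ht.2
  have ht1 : 0 < 1 / t := by positivity
  have ht2 : 0 < 1 / (1 - t) := by positivity
  have hlo : -(1 / (1 - t)) ≤ (q - 1) / (1 + t * (q - 1)) := by
    rw [← neg_div, div_le_div_iff₀ h1 hpos]
    nlinarith
  have hhi : (q - 1) / (1 + t * (q - 1)) ≤ 1 / t := by
    rw [div_le_div_iff₀ hpos h0]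
    nlinarith
  rw [abs_le]
  constructor <;> linarith

lemma affinePath_add_one (hF : IsDiffeoLift F) (t x : ℝ) :
    affinePath F t (x + 1) = affinePath F t x + 1 := by
  rw [affinePath, affinePath, hF.add_one]
  ring

/-- In the variable `x` with `y = affinePath F t x`, the Jacobian cancels the denominator and leaves
`∫ |F' - 1| ≤ ∫ F' + 1 = 2`. -/
lemma lintegral_enorm_deriv_velocity_affinePath_le (hF : IsDiffeoLift F)
    (ht : t ∈ Icc (0 : ℝ) 1) :
    ∫⁻ y in Ioc (0 : ℝ) 1, ‖deriv (velocity (affinePath F) t) y‖ₑ ≤ 2 := by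
  have hΦ := isDiffeoLift_affinePath hF ht
  have hper := periodic_deriv ((isPath_affinePath hF).periodic_velocity ht)
  have hp : Function.Periodic (fun y => ‖deriv (velocity (affinePath F) t) y‖ₑ) 1 := fun y => by
    simp only [hper y]
  have himg : affinePath F t '' Ioc 0 1 = Ioc (affinePath F t 0) (affinePath F t 0 + 1) := by
    have h1 : affinePath F t 0 + 1 = affinePath F t 1 := by
      rw [← affinePath_add_one hF, zero_add]
    rw [h1]
    exact (hΦ.strictMono.orderIsoOfSurjective _ hΦ.surjective).image_Ioc 0 1
  rw [← setLIntegral_Ioc_add_one hp (affinePath F t 0), ← himg,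
    lintegral_image_eq_lintegral_abs_deriv_mul measurableSet_Ioc
      (fun x _ => (hasDerivAt_affinePath hF t x).hasDerivWithinAt) hΦ.strictMono.injective.injOn]
  have hcont : Continuous (deriv F) := hF.smooth.continuous_deriv (by simp)
  calc _ = ∫⁻ x in Ioc (0 : ℝ) 1, ‖deriv F x - 1‖ₑ := by
        congr 1
        ext x
        have hpos := one_add_mul_pos ht (hF.deriv_pos x)
        rw [deriv_velocity_affinePath hF ht, ← Real.norm_eq_abs, ofReal_norm, ← enorm_mul,
          mul_div_cancel₀ _ hpos.ne']
    _ ≤ ∫⁻ x in Ioc (0 : ℝ) 1, (‖deriv F x‖ₑ + ‖(1 : ℝ)‖ₑ) :=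
        lintegral_mono fun x => enorm_sub_le
    _ = 2 := by
        rw [lintegral_add_right _ measurable_const,
          lintegral_enorm_deriv_eq_of_nonneg (hF.smooth.of_le (by exact_mod_cast le_top))
            zero_le_one (fun x _ => (hF.deriv_pos x).le)]
        have : F 1 - F 0 = 1 := by
          have := hF.add_one 0
          rw [zero_add] at this
          linarith
        rw [this]
        simp
        norm_num

/-- The velocities of the affine path to a diffeomorphism with unimodal derivative are controlled
by a bound that does not depend on the diffeomorphism. -/
lemma controlled_velocity_affinePath (hF : IsDiffeoLift F) (hb : ∀ x, |F x - x| ≤ 1) {a b : ℝ}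
    (hab : a ≤ b) (hba : b ≤ a + 1) (hmono : MonotoneOn (deriv F) (Icc a b))
    (hanti : AntitoneOn (deriv F) (Icc b (a + 1))) (ht : t ∈ Ioo (0 : ℝ) 1) :
    Controlled (1 / t + 1 / (1 - t)) (velocity (affinePath F) t) := by
  have htI : t ∈ Icc (0 : ℝ) 1 := Ioo_subset_Icc_self ht
  have hP := isPath_affinePath hF
  have hΦ := isDiffeoLift_affinePath hF htI
  have hsm := hP.contDiff_velocity htI
  have hper := hP.periodic_velocity htI
  have hM : ∀ y, |deriv (velocity (affinePath F) t) y| ≤ 1 / t + 1 / (1 - t) := fun y => by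
    obtain ⟨x, rfl⟩ := hΦ.surjective y
    rw [deriv_velocity_affinePath hF htI]
    exact abs_div_one_add_mul_le ht (hF.deriv_pos x)
  refine ⟨hsm, hper, fun y => ?_, hM, lintegral_enorm_deriv_velocity_affinePath_le hF htI, ?_⟩
  · obtain ⟨x, rfl⟩ := hΦ.surjective y
    rw [velocity_affinePath hF htI]
    exact hb x
  · refine lintegral_enorm_deriv_le_of_unimodal
      (a := affinePath F t a) (b := affinePath F t b)
      (((contDiff_infty_iff_deriv.1 hsm).2).of_le (by exact_mod_cast le_top))
      (periodic_deriv hper) (hΦ.strictMono.monotone hab) ?_ ?_ ?_ hM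
    · rw [← affinePath_add_one hF]
      exact hΦ.strictMono.monotone hba
    · intro y hy z hz hyz
      obtain ⟨x, rfl⟩ := hΦ.surjective y
      obtain ⟨w, rfl⟩ := hΦ.surjective z
      simp only [mem_Icc, hΦ.strictMono.le_iff_le] at hy hz hyz
      rw [deriv_velocity_affinePath hF htI, deriv_velocity_affinePath hF htI]
      exact div_one_add_mul_mono htI (hF.deriv_pos x) (hmono hy hz hyz)
    · rw [← affinePath_add_one hF]
      intro y hy z hz hyz
      obtain ⟨x, rfl⟩ := hΦ.surjective y
      obtain ⟨w, rfl⟩ := hΦ.surjective z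
      simp only [mem_Icc, hΦ.strictMono.le_iff_le] at hy hz hyz
      rw [deriv_velocity_affinePath hF htI, deriv_velocity_affinePath hF htI]
      exact div_one_add_mul_mono htI (hF.deriv_pos w) (hanti hy hz hyz)

end AffinePath

/-- Subadditivity of the `θ`-th power separates the two end point singularities, which are exchanged
by `t ↦ 1 - t`. -/
lemma lintegral_inv_add_inv_rpow_lt_top {θ : ℝ} (h0 : 0 ≤ θ) (h1 : θ < 1) :
    ∫⁻ t in Ioo (0 : ℝ) 1, ENNReal.ofReal (1 / t + 1 / (1 - t)) ^ θ < ⊤ := by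
  have hI : ∫⁻ t in Ioc (0 : ℝ) 1, ‖t‖ₑ ^ (-θ) < ⊤ :=
    setLIntegral_enorm_rpow_lt_top (by linarith) 1 zero_le_one
  have hJ : ∫⁻ t in Ioo (0 : ℝ) 1, ‖1 - t‖ₑ ^ (-θ) = ∫⁻ t in Ioo (0 : ℝ) 1, ‖t‖ₑ ^ (-θ) := by
    have h := (Measure.measurePreserving_sub_left (volume : Measure ℝ) 1).setLIntegral_comp_preimage_emb
      (measurableEmbedding_subLeft 1) (fun t => ‖t‖ₑ ^ (-θ)) (Ioo (0 : ℝ) 1)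
    rw [← h]
    simp
  rw [← restrict_Ioo_eq_restrict_Ioc] at hI
  calc ∫⁻ t in Ioo (0 : ℝ) 1, ENNReal.ofReal (1 / t + 1 / (1 - t)) ^ θ
      ≤ ∫⁻ t in Ioo (0 : ℝ) 1, (‖t‖ₑ ^ (-θ) + ‖1 - t‖ₑ ^ (-θ)) := by
        refine setLIntegral_mono' measurableSet_Ioo fun t ht => ?_
        have h1t : 0 < 1 - t := sub_pos.2 ht.2
        have h0t : 0 < t := ht.1
        rw [ENNReal.ofReal_add (by positivity) (by positivity), one_div, one_div,
          ENNReal.ofReal_inv_of_pos h0t, ENNReal.ofReal_inv_of_pos h1t,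
          ← Real.enorm_eq_ofReal h0t.le, ← Real.enorm_eq_ofReal h1t.le, ENNReal.rpow_neg,
          ENNReal.rpow_neg, ← ENNReal.inv_rpow, ← ENNReal.inv_rpow]
        exact ENNReal.rpow_add_le_add_rpow _ _ h0 h1.le
    _ < ⊤ := by
        rw [lintegral_add_left ((by fun_prop : Measurable (fun t : ℝ => ‖t‖ₑ)).pow_const _), hJ]
        exact ENNReal.add_lt_top.2 ⟨hI, hI⟩

/-- For a functional of sublinear growth, affine paths to diffeomorphisms with unimodal derivative
have bounded length. -/
lemma exists_pathLength_affinePath_le {X : (ℝ → ℝ) → ℝ≥0∞} (hX : SublinearOnControlled X) :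
    ∃ C : ℝ≥0, ∀ F : ℝ → ℝ, IsDiffeoLift F → (∀ x, |F x - x| ≤ 1) → ∀ a b : ℝ, a ≤ b →
      b ≤ a + 1 → MonotoneOn (deriv F) (Icc a b) → AntitoneOn (deriv F) (Icc b (a + 1)) →
      pathLength X (affinePath F) ≤ C := by
  obtain ⟨C, θ, hθ, hC⟩ := hX
  -- Sublinear growth permits a negative `θ`; replacing it by `max θ 0` only weakens the bound since
  -- `M ≥ 1`.
  have hI := lintegral_inv_add_inv_rpow_lt_top (le_max_right θ 0) (max_lt hθ zero_lt_one)
  refine ⟨C * (∫⁻ t in Ioo (0 : ℝ) 1, ENNReal.ofReal (1 / t + 1 / (1 - t)) ^ max θ 0).toNNReal,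
    fun F hF hb a b hab hba hmono hanti => ?_⟩
  rw [ENNReal.coe_mul, ENNReal.coe_toNNReal hI.ne, pathLength, ← restrict_Ioo_eq_restrict_Icc,
    ← lintegral_const_mul' _ _ ENNReal.coe_ne_top]
  refine setLIntegral_mono' measurableSet_Ioo fun t ht => ?_
  have h1t : 0 < 1 - t := sub_pos.2 ht.2
  have h0t : 0 < t := ht.1
  have hM : 1 ≤ 1 / t + 1 / (1 - t) := by
    have h1 : 1 ≤ 1 / t := (one_le_div h0t).2 ht.2.le
    have h2 : 0 < 1 / (1 - t) := by positivity
    linarith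
  refine (hC _ hM _ (controlled_velocity_affinePath hF hb hab hba hmono hanti ht)).trans ?_
  gcongr
  · simpa using hM
  · exact le_max_left _ _

/-! ### Hyperbolic Möbius transformations of the circle -/

/-- The lift of the Möbius transformation `z ↦ (z + a) / (1 + a z)` of the unit circle. -/
def mobiusLift (a u : ℝ) : ℝ :=
  u - Real.pi⁻¹ *
    Real.arctan (a * Real.sin (2 * Real.pi * u) / (1 + a * Real.cos (2 * Real.pi * u)))

section Mobius

variable {a : ℝ}

lemma one_add_mul_cos_pos (ha : a ∈ Ioo (0 : ℝ) 1) (y : ℝ) : 0 < 1 + a * Real.cos y := by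
  nlinarith [Real.neg_one_le_cos y, ha.1, ha.2]

lemma poisson_denom_pos (ha : a ∈ Ioo (0 : ℝ) 1) (y : ℝ) :
    0 < 1 + 2 * a * Real.cos y + a ^ 2 := by
  nlinarith [Real.neg_one_le_cos y, ha.1, ha.2, mul_pos (sub_pos.2 ha.2) (sub_pos.2 ha.2)]

/-- The derivative is a Poisson kernel, a decreasing function of the cosine; hence its unimodality.
-/
lemma hasDerivAt_mobiusLift (ha : a ∈ Ioo (0 : ℝ) 1) (u : ℝ) :
    HasDerivAt (mobiusLift a)
      ((1 - a ^ 2) / (1 + 2 * a * Real.cos (2 * Real.pi * u) + a ^ 2)) u := by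
  have hl : HasDerivAt (fun u : ℝ => 2 * Real.pi * u) (2 * Real.pi) u := by
    simpa using (hasDerivAt_id u).const_mul (2 * Real.pi)
  have hd := one_add_mul_cos_pos ha (2 * Real.pi * u)
  have hD := poisson_denom_pos ha (2 * Real.pi * u)
  have h := (hasDerivAt_id u).sub
    ((((hl.sin.const_mul a).div ((hl.cos.const_mul a).const_add 1) hd.ne').arctan).const_mul
      Real.pi⁻¹)
  refine h.congr_deriv ?_
  have hsc := Real.sin_sq_add_cos_sq (2 * Real.pi * u)
  set s := Real.sin (2 * Real.pi * u)
  set k := Real.cos (2 * Real.pi * u)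
  have hq : 1 + (a * s / (1 + a * k)) ^ 2 = (1 + 2 * a * k + a ^ 2) / (1 + a * k) ^ 2 := by
    field_simp
    linear_combination a ^ 2 * hsc
  simp only [Pi.div_apply]
  rw [hq]
  have hpi := Real.pi_ne_zero
  have hs : s ^ 2 = 1 - k ^ 2 := by linarith
  field_simp
  ring_nf
  rw [hs]
  ring

lemma contDiff_mobiusLift (ha : a ∈ Ioo (0 : ℝ) 1) : ContDiff ℝ ∞ (mobiusLift a) := by
  have h1 : ContDiff ℝ ∞ (fun u => a * Real.sin (2 * Real.pi * u) /
      (1 + a * Real.cos (2 * Real.pi * u))) :=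
    ContDiff.div (by fun_prop) (by fun_prop) (fun u => (one_add_mul_cos_pos ha _).ne')
  exact contDiff_id.sub (contDiff_const.mul (Real.contDiff_arctan.comp h1))

lemma isDiffeoLift_mobiusLift (ha : a ∈ Ioo (0 : ℝ) 1) : IsDiffeoLift (mobiusLift a) where
  smooth := contDiff_mobiusLift ha
  add_one u := by
    rw [mobiusLift, mobiusLift, mul_add, mul_one, Real.sin_add_two_pi, Real.cos_add_two_pi]
    ring
  deriv_pos u := by
    rw [(hasDerivAt_mobiusLift ha u).deriv]
    refine div_pos ?_ (poisson_denom_pos ha _)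
    nlinarith [ha.1, ha.2]

lemma abs_mobiusLift_sub_le (a u : ℝ) : |mobiusLift a u - u| ≤ 1 / 2 := by
  set y := a * Real.sin (2 * Real.pi * u) / (1 + a * Real.cos (2 * Real.pi * u)) with hy
  have h1 : |Real.arctan y| ≤ Real.pi / 2 :=
    abs_le.2 ⟨(Real.neg_pi_div_two_lt_arctan y).le, (Real.arctan_lt_pi_div_two y).le⟩
  have h2 : mobiusLift a u - u = -(Real.pi⁻¹ * Real.arctan y) := by
    rw [mobiusLift, ← hy]
    ring
  rw [h2, abs_neg, abs_mul, abs_of_pos (inv_pos.2 Real.pi_pos)]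
  calc Real.pi⁻¹ * |Real.arctan y| ≤ Real.pi⁻¹ * (Real.pi / 2) := by gcongr
    _ = 1 / 2 := by field_simp

lemma mobiusLift_neg (a u : ℝ) : mobiusLift a (-u) = -mobiusLift a u := by
  rw [mobiusLift, mobiusLift, mul_neg, Real.sin_neg, Real.cos_neg, mul_neg, neg_div,
    Real.arctan_neg]
  ring

lemma deriv_mobiusLift_le_of_cos_le (ha : a ∈ Ioo (0 : ℝ) 1) {u w : ℝ}
    (h : Real.cos (2 * Real.pi * w) ≤ Real.cos (2 * Real.pi * u)) :
    deriv (mobiusLift a) u ≤ deriv (mobiusLift a) w := by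
  have h0 := ha.1
  have h1 : 0 ≤ 1 - a ^ 2 := by nlinarith [ha.2]
  rw [(hasDerivAt_mobiusLift ha u).deriv, (hasDerivAt_mobiusLift ha w).deriv]
  refine div_le_div_of_nonneg_left h1 (poisson_denom_pos ha _) ?_
  gcongr

lemma monotoneOn_deriv_mobiusLift (ha : a ∈ Ioo (0 : ℝ) 1) :
    MonotoneOn (deriv (mobiusLift a)) (Icc 0 (1 / 2)) := by
  intro u hu w hw huw
  have hpi := Real.pi_pos
  refine deriv_mobiusLift_le_of_cos_le ha (Real.antitoneOn_cos ?_ ?_ ?_)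
  · exact ⟨by nlinarith [hu.1], by nlinarith [hu.2]⟩
  · exact ⟨by nlinarith [hw.1], by nlinarith [hw.2]⟩
  · nlinarith

lemma antitoneOn_deriv_mobiusLift (ha : a ∈ Ioo (0 : ℝ) 1) :
    AntitoneOn (deriv (mobiusLift a)) (Icc (1 / 2) 1) := by
  intro u hu w hw huw
  have hpi := Real.pi_pos
  have hc : ∀ x, Real.cos (2 * Real.pi * x) = Real.cos (2 * Real.pi * (1 - x)) := fun x => by
    rw [mul_sub, mul_one, Real.cos_two_pi_sub]
  refine deriv_mobiusLift_le_of_cos_le ha ?_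
  rw [hc u, hc w]
  refine Real.antitoneOn_cos ?_ ?_ ?_
  · exact ⟨by nlinarith [hw.2], by nlinarith [hw.1]⟩
  · exact ⟨by nlinarith [hu.2], by nlinarith [hu.1]⟩
  · nlinarith

/-- Möbius transformations contract every proper arc to an arbitrarily small one. -/
lemma exists_abs_mobiusLift_lt {r ε : ℝ} (hr0 : 0 ≤ r) (hr : r < 1 / 2) (hε : 0 < ε) :
    ∃ a ∈ Ioo (0 : ℝ) 1, ∀ u, |u| ≤ r → |mobiusLift a u| < ε := by
  have hpi := Real.pi_pos
  have hcos : 0 < Real.cos (Real.pi * r) :=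
    Real.cos_pos_of_mem_Ioo ⟨by nlinarith, by nlinarith⟩
  have h2 : 2 * Real.pi * r = 2 * (Real.pi * r) := by ring
  have hden : 1 + 1 * Real.cos (2 * Real.pi * r) = 2 * Real.cos (Real.pi * r) ^ 2 := by
    rw [h2, Real.cos_two_mul]
    ring
  -- At the degenerate parameter `a = 1` the formula becomes `r - π⁻¹ arctan (tan (π r))`, which
  -- vanishes for `0 ≤ r < 1/2`. Continuity in `a` then gives parameters below `1`; oddness and
  -- monotonicity in `u` cover all `|u| ≤ r`.
  have hval : mobiusLift 1 r = 0 := by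
    rw [mobiusLift, hden, h2, Real.sin_two_mul]
    have : 1 * (2 * Real.sin (Real.pi * r) * Real.cos (Real.pi * r)) /
        (2 * Real.cos (Real.pi * r) ^ 2) = Real.tan (Real.pi * r) := by
      rw [Real.tan_eq_sin_div_cos]
      field_simp
    rw [this, Real.arctan_tan (by nlinarith) (by nlinarith)]
    field_simp
    ring
  have hcont : ContinuousAt (fun a => mobiusLift a r) 1 := by
    unfold mobiusLift
    refine continuousAt_const.sub (continuousAt_const.mul (Real.continuous_arctan.continuousAt.comp ?_))
    refine ContinuousAt.div (by fun_prop) (by fun_prop) ?_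
    rw [hden]
    positivity
  have hlt : ∀ᶠ a in nhds (1 : ℝ), mobiusLift a r < ε :=
    hcont.eventually (gt_mem_nhds (by simpa only [hval] using hε))
  have hev := (hlt.filter_mono nhdsWithin_le_nhds).and
    (Ioo_mem_nhdsLT (show (0 : ℝ) < 1 by norm_num))
  obtain ⟨a, h1, ha⟩ := hev.exists
  refine ⟨a, ha, fun u hu => ?_⟩
  have hmono := (isDiffeoLift_mobiusLift ha).strictMono.monotone
  rw [abs_le] at hu
  have hlo := hmono hu.1
  have hhi := hmono hu.2
  rw [mobiusLift_neg] at hlo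
  rw [abs_lt]
  constructor <;> linarith

end Mobius

/-! ### Upper bounds for the displacement energy -/

lemma displacementEnergy_le {N : (ℝ → ℝ) → ℝ≥0∞} {A : Set UnitAddCircle} {F : ℝ → ℝ}
    (hF : IsDiffeoLift F) (hA : hF.toDiffeo.toFun '' A ∩ A = ∅) {Φ : ℝ → ℝ → ℝ}
    (hΦ : IsPath Φ Diffeo.id hF.toDiffeo) : displacementEnergy N A ≤ pathLength N Φ :=
  (iInf₂_le hF.toDiffeo hA).trans (iInf₂_le Φ hΦ)

lemma unitAddCircle_coe_eq_coe_iff {x y : ℝ} :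
    (x : UnitAddCircle) = (y : UnitAddCircle) ↔ ∃ n : ℤ, x = y + n := by
  rw [← sub_eq_zero, ← AddCircle.coe_sub, AddCircle.coe_eq_zero_iff]
  refine exists_congr fun n => ?_
  rw [zsmul_one]
  constructor <;> intro h <;> linarith

lemma image_arc_inter_arc_eq_empty {F : ℝ → ℝ} (hF : IsDiffeoLift F) {I : Set ℝ}
    (h : ∀ x ∈ I, ∀ y ∈ I, ∀ n : ℤ, F x ≠ y + n) :
    hF.toDiffeo.toFun '' arc I ∩ arc I = ∅ := by
  rw [eq_empty_iff_forall_notMem]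
  rintro _ ⟨⟨_, ⟨x, hx, rfl⟩, rfl⟩, ⟨y, hy, hxy⟩⟩
  simp only [hF.toDiffeo_apply] at hxy
  obtain ⟨n, hn⟩ := unitAddCircle_coe_eq_coe_iff.1 hxy.symm
  exact h x hx y hy n hn

lemma abs_int_sub_half (n : ℤ) : (1 / 2 : ℝ) ≤ |(n : ℝ) - 1 / 2| := by
  rcases le_or_gt n 0 with h | h
  · have : (n : ℝ) ≤ 0 := by exact_mod_cast h
    rw [abs_of_nonpos (by linarith)]
    linarith
  · have : (1 : ℝ) ≤ n := by exact_mod_cast h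
    rw [abs_of_nonneg (by linarith)]
    linarith

lemma IsDiffeoLift.shift {F : ℝ → ℝ} (hF : IsDiffeoLift F) (c d : ℝ) :
    IsDiffeoLift (fun x => F (x - c) + d) where
  smooth := (hF.smooth.comp (contDiff_id.sub contDiff_const)).add contDiff_const
  add_one x := by
    rw [show x + 1 - c = x - c + 1 by ring, hF.add_one]
    ring
  deriv_pos x := by
    rw [deriv_add_const, deriv_comp_sub_const]
    exact hF.deriv_pos _

theorem exists_displacementEnergy_arc_lt {X : (ℝ → ℝ) → ℝ≥0∞} (hX : SublinearOnControlled X) :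
    ∃ C : ℝ, 0 < C ∧ ∀ a b : ℝ, b - a < 1 →
      displacementEnergy X (arc (Ioo a b)) < ENNReal.ofReal C := by
  obtain ⟨C, hC⟩ := exists_pathLength_affinePath_le hX
  -- The extra `1` makes the inequality strict. The `max` with `0` below covers empty intervals.
  refine ⟨C + 1, by positivity, fun α β hαβ => ?_⟩
  set r : ℝ := max 0 ((β - α) / 2) with hr
  set c : ℝ := (α + β) / 2 with hc
  have hr0 : 0 ≤ r := le_max_left _ _
  have hr1 : r < 1 / 2 := max_lt (by norm_num) (by linarith)
  -- The arc lies within `r` of `c`, its image within less than `1/2 - r` of `c + 1/2`; as the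
  -- centres are at distance `1/2` on the circle, the two are disjoint.
  obtain ⟨a, ha, hsmall⟩ := exists_abs_mobiusLift_lt hr0 hr1 (sub_pos.2 hr1)
  have hF := (isDiffeoLift_mobiusLift ha).shift c (c + 1 / 2)
  have hmem : ∀ x ∈ Ioo α β, |x - c| ≤ r := fun x hx => by
    refine le_trans ?_ (le_max_right _ _)
    rw [abs_le]
    constructor <;> linarith [hx.1, hx.2]
  have hdisj : ∀ x ∈ Ioo α β, ∀ y ∈ Ioo α β, ∀ n : ℤ,
      mobiusLift a (x - c) + (c + 1 / 2) ≠ y + n := by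
    intro x hx y hy n h
    have h1 := abs_lt.1 (hsmall _ (hmem x hx))
    have h2 := abs_le.1 (hmem y hy)
    have h3 : (n : ℝ) - 1 / 2 = mobiusLift a (x - c) - (y - c) := by linarith
    have h4 : |(n : ℝ) - 1 / 2| < 1 / 2 := by
      rw [h3, abs_lt]
      constructor <;> linarith
    exact absurd (abs_int_sub_half n) (not_le.2 h4)
  have hderiv : ∀ x, deriv (fun x => mobiusLift a (x - c) + (c + 1 / 2)) x =
      deriv (mobiusLift a) (x - c) := fun x => by
    rw [deriv_add_const, deriv_comp_sub_const]
  refine (displacementEnergy_le hF (image_arc_inter_arc_eq_empty hF hdisj)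
    (isPath_affinePath hF)).trans_lt (lt_of_le_of_lt (hC _ hF (fun x => ?_) c (c + 1 / 2)
      (by linarith) (by linarith) ?_ ?_) ?_)
  · have h1 := abs_le.1 (abs_mobiusLift_sub_le a (x - c))
    rw [abs_le]
    constructor <;> linarith
  · intro x hx y hy hxy
    rw [hderiv, hderiv]
    exact monotoneOn_deriv_mobiusLift ha ⟨by linarith [hx.1], by linarith [hx.2]⟩
      ⟨by linarith [hy.1], by linarith [hy.2]⟩ (by linarith)
  · intro x hx y hy hxy
    rw [hderiv, hderiv]
    exact antitoneOn_deriv_mobiusLift ha ⟨by linarith [hx.1], by linarith [hx.2]⟩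
      ⟨by linarith [hy.1], by linarith [hy.2]⟩ (by linarith)
  · rw [ENNReal.ofReal_add (by positivity) zero_le_one, ENNReal.ofReal_coe_nnreal]
    exact ENNReal.lt_add_right ENNReal.coe_ne_top (by simp)

lemma isDiffeoLift_rotation (r : ℝ) : IsDiffeoLift (fun x => x + r) where
  smooth := contDiff_id.add contDiff_const
  add_one x := by ring
  deriv_pos x := by simp

lemma sobolevNorm_const {s p : ℝ} (hp : 1 ≤ p) (c : ℝ) :
    sobolevNorm s p (fun _ => c) = ‖c‖ₑ := by
  have hp0 : 0 < p := by linarith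
  have hd : ∀ j, iteratedDeriv (j + 1) (fun _ : ℝ => c) = fun _ => 0 := fun j => by
    ext x
    simp [iteratedDeriv_const]
  have hg : ∀ σ k, gagliardo σ p (iteratedDeriv k (fun _ : ℝ => c)) = 0 := fun σ k => by
    cases k <;> simp [gagliardo, hd, hp0]
  rw [sobolevNorm, hg, ite_self, add_zero, intSobolevNorm, Finset.sum_range_succ']
  simp only [hd, iteratedDeriv_zero, eLpNorm_zero', Finset.sum_const_zero, zero_add]
  rw [eLpNorm_const _ (by simpa using hp0) (by simp)]
  simp

lemma displacementEnergy_arc_le_half {s p : ℝ} (hp : 1 ≤ p) {I : Set ℝ} (hI : I.OrdConnected)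
    (hvol : volume I < 1 / 2) : displacementEnergy (sobolevNorm s p) (arc I) ≤ 1 / 2 := by
  have hF := isDiffeoLift_rotation (1 / 2)
  have hdist : ∀ x ∈ I, ∀ y ∈ I, y - x < 1 / 2 := fun x hx y hy => by
    have h1 := (measure_mono (hI.out hx hy)).trans_lt hvol
    rw [Real.volume_Icc] at h1
    have h2 : (1 / 2 : ℝ≥0∞) = ENNReal.ofReal (1 / 2) := by
      rw [ENNReal.ofReal_div_of_pos two_pos]
      simp
    rw [h2] at h1
    exact (ENNReal.ofReal_lt_ofReal_iff (by norm_num)).1 h1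
  have hdisj : ∀ x ∈ I, ∀ y ∈ I, ∀ n : ℤ, x + 1 / 2 ≠ y + n := by
    intro x hx y hy n h
    have h1 := hdist x hx y hy
    have h2 := hdist y hy x hx
    have h4 : |(n : ℝ) - 1 / 2| < 1 / 2 := by
      rw [abs_lt]
      constructor <;> linarith
    exact absurd (abs_int_sub_half n) (not_le.2 h4)
  refine (displacementEnergy_le hF (image_arc_inter_arc_eq_empty hF hdisj)
    (isPath_affinePath hF)).trans ?_
  have hv : ∀ t ∈ Icc (0 : ℝ) 1, sobolevNorm s p (velocity (affinePath (fun x => x + 1 / 2)) t) =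
      1 / 2 := fun t ht => by
    have : velocity (affinePath (fun x => x + 1 / 2)) t = fun _ => 1 / 2 := by
      ext y
      obtain ⟨x, rfl⟩ := (isDiffeoLift_affinePath hF ht).surjective y
      rw [velocity_affinePath hF ht]
      ring
    rw [this, sobolevNorm_const hp, Real.enorm_eq_ofReal (by norm_num),
      ENNReal.ofReal_div_of_pos two_pos]
    simp
  rw [pathLength, setLIntegral_congr_fun measurableSet_Icc hv]
  simp

/-! ### Sobolev embeddings above the critical exponent -/

/-- Average `|f x| ≤ |f y| + ∫ |f'|` over `y` in one period. -/
lemma enorm_le_add_lintegral_deriv {f : ℝ → ℝ} (hf : ContDiff ℝ 1 f)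
    (hper : Function.Periodic f 1) (x : ℝ) :
    ‖f x‖ₑ ≤ (∫⁻ y in Ioc (0 : ℝ) 1, ‖f y‖ₑ) + ∫⁻ y in Ioc (0 : ℝ) 1, ‖deriv f y‖ₑ := by
  set T := ∫⁻ y in Ioc (0 : ℝ) 1, ‖deriv f y‖ₑ
  have hP : Function.Periodic (fun x => ‖f x‖ₑ) 1 := fun x => by simp only [hper x]
  have hP' : Function.Periodic (fun x => ‖deriv f x‖ₑ) 1 := fun x => by
    simp only [periodic_deriv hper x]
  have h1 : ∀ y ∈ Ioc x (x + 1), ‖f x‖ₑ ≤ ‖f y‖ₑ + T := fun y hy => by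
    have h2 := enorm_sub_le_lintegral_deriv hf (x := x) (h := y - x)
    rw [add_sub_cancel, uIoc_of_le (by linarith [hy.1])] at h2
    have h3 : ∫⁻ s in Ioc 0 (y - x), ‖deriv f (x + s)‖ₑ ≤ T := by
      rw [setLIntegral_Ioc_comp_add_left (fun s => ‖deriv f s‖ₑ)]
      exact setLIntegral_periodic_mono hP' (by linarith [hy.2])
    calc ‖f x‖ₑ = ‖f y - (f y - f x)‖ₑ := by rw [sub_sub_cancel]
      _ ≤ ‖f y‖ₑ + ‖f y - f x‖ₑ := enorm_sub_le
      _ ≤ _ := by gcongr; exact h2.trans h3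
  calc ‖f x‖ₑ = ∫⁻ _ in Ioc x (x + 1), ‖f x‖ₑ := by simp
    _ ≤ ∫⁻ y in Ioc x (x + 1), (‖f y‖ₑ + T) := setLIntegral_mono' measurableSet_Ioc h1
    _ = _ := by
      rw [lintegral_add_right _ measurable_const, setLIntegral_Ioc_add_one hP]
      simp

lemma lintegral_enorm_le_eLpNorm {p : ℝ} (hp : 1 ≤ p) {f : ℝ → ℝ} (hf : Continuous f) :
    ∫⁻ y in Ioc (0 : ℝ) 1, ‖f y‖ₑ ≤
      eLpNorm f (ENNReal.ofReal p) (volume.restrict (Ioc (0 : ℝ) 1)) := by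
  have : IsProbabilityMeasure (volume.restrict (Ioc (0 : ℝ) 1)) := ⟨by simp⟩
  rw [← eLpNorm_one_eq_lintegral_enorm]
  exact eLpNorm_le_eLpNorm_of_exponent_le (by simpa using hp) hf.aestronglyMeasurable

lemma enorm_iteratedDeriv_le_intSobolevNorm {p : ℝ} (hp : 1 ≤ p) {f : ℝ → ℝ}
    (hf : ContDiff ℝ ∞ f) (hper : Function.Periodic f 1) {j k : ℕ} (hjk : j < k) (x : ℝ) :
    ‖iteratedDeriv j f x‖ₑ ≤ intSobolevNorm k p f := by
  have hper' : ∀ i, Function.Periodic (iteratedDeriv i f) 1 := fun i => by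
    induction i with
    | zero => simpa using hper
    | succ i ih =>
      rw [iteratedDeriv_succ]
      exact periodic_deriv ih
  have hsm : ∀ i, ContDiff ℝ 1 (iteratedDeriv i f) := fun i => by
    have h := hf.of_le (m := 1 + i) (by exact_mod_cast le_top)
    exact h.iterate_deriv' 1 i |> (by rw [iteratedDeriv_eq_iterate]; exact ·)
  refine (enorm_le_add_lintegral_deriv (hsm j) (hper' j) x).trans ?_
  rw [← iteratedDeriv_succ, intSobolevNorm]
  have hsub : ({j, j + 1} : Finset ℕ) ⊆ Finset.range (k + 1) := by
    intro i hi
    simp only [Finset.mem_insert, Finset.mem_singleton] at hi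
    simp only [Finset.mem_range]
    omega
  refine le_trans ?_ (Finset.sum_le_sum_of_subset hsub)
  rw [Finset.sum_pair (by omega)]
  exact add_le_add (lintegral_enorm_le_eLpNorm hp (hsm _).continuous)
    (lintegral_enorm_le_eLpNorm hp (hsm _).continuous)

/-! ### Fractional Morrey inequality by dyadic averages -/

/-- The average of `g` over `(x, x + r)`. -/
def rightAverage (g : ℝ → ℝ) (x r : ℝ) : ℝ := r⁻¹ * ∫ z in x..x + r, g z

lemma enorm_rightAverage_sub_le {g : ℝ → ℝ} (hg : Continuous g) {x r : ℝ} (hr : 0 < r) (b : ℝ) :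
    ‖rightAverage g x r - b‖ₑ ≤
      (ENNReal.ofReal r)⁻¹ * ∫⁻ z in Ioc x (x + r), ‖g z - b‖ₑ := by
  have h1 : rightAverage g x r - b = r⁻¹ * ∫ z in x..x + r, (g z - b) := by
    rw [intervalIntegral.integral_sub (hg.intervalIntegrable _ _) (by simp),
      intervalIntegral.integral_const, rightAverage, mul_sub, add_sub_cancel_left, smul_eq_mul,
      inv_mul_cancel_left₀ hr.ne']
  rw [h1, enorm_mul, Real.enorm_eq_ofReal (inv_nonneg.2 hr.le), ENNReal.ofReal_inv_of_pos hr,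
    intervalIntegral.integral_of_le (by linarith)]
  gcongr
  exact enorm_integral_le_lintegral_enorm _

lemma le_div_mul_of_le {a b c : ℝ≥0∞} (hbc : b ≤ c) (h0 : c ≠ 0) (h1 : c ≠ ⊤) :
    a ≤ a / b * c := by
  calc a = a / c * c := (ENNReal.div_mul_cancel h0 h1).symm
    _ ≤ _ := by gcongr

/-- Hölder's inequality on a square of side `r`. -/
lemma lintegral_lintegral_le_rpow {g : ℝ → ℝ} (hg : Continuous g) {p : ℝ} (hp : 1 ≤ p)
    (x r : ℝ) :
    ∫⁻ y in Ioc x (x + r), ∫⁻ z in Ioc x (x + r), ‖g z - g y‖ₑ ≤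
      (∫⁻ y in Ioc x (x + r), ∫⁻ z in Ioc x (x + r), ‖g z - g y‖ₑ ^ p) ^ (1 / p) *
        ENNReal.ofReal r ^ (2 * (1 - 1 / p)) := by
  set μ := volume.restrict (Ioc x (x + r)) with hμ
  have hp0 : 0 < p := by linarith
  have hK : Continuous (fun q : ℝ × ℝ => g q.2 - g q.1) := by fun_prop
  have h := eLpNorm_le_eLpNorm_mul_rpow_measure_univ (μ := μ.prod μ) (p := 1)
    (q := ENNReal.ofReal p) (f := fun q : ℝ × ℝ => g q.2 - g q.1) (by simpa using hp)
    hK.aestronglyMeasurable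
  have huniv : (μ.prod μ) univ = ENNReal.ofReal r ^ (2 : ℝ) := by
    rw [← univ_prod_univ, Measure.prod_prod, hμ, Measure.restrict_apply_univ, Real.volume_Ioc,
      add_sub_cancel_left, ENNReal.rpow_two, sq]
  rw [eLpNorm_one_eq_lintegral_enorm, eLpNorm_eq_lintegral_rpow_enorm_toReal (by simpa using hp0)
    ENNReal.ofReal_ne_top, huniv, ENNReal.toReal_ofReal hp0.le,
    lintegral_prod _ hK.enorm.measurable.aemeasurable,
    lintegral_prod _ (hK.enorm.measurable.pow_const p).aemeasurable, ← ENNReal.rpow_mul] at h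
  simpa using h

lemma edist_coe_le (y z : ℝ) :
    edist (z : UnitAddCircle) (y : UnitAddCircle) ≤ ENNReal.ofReal |z - y| := by
  rw [edist_dist, dist_eq_norm, ← AddCircle.coe_sub]
  apply ENNReal.ofReal_le_ofReal
  exact QuotientAddGroup.norm_mk_le_norm

/-- The difference of averages is at most `2 r⁻²` times the integral of `|g z - g y|` over a square
of side `r`. There the circle distance is at most `r`, so the Gagliardo integrand bounds `|g z - g
y| ^ p` up to the factor `r ^ (1 + σ p)`. With Hölder the exponents add up to `-2 + (1 + σ p)/p + 2
(1 - 1/p) = σ - 1/p`. -/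
lemma enorm_rightAverage_half_sub_le {g : ℝ → ℝ} (hg : Continuous g)
    (hper : Function.Periodic g 1) {σ p : ℝ} (hσ : 0 ≤ σ) (hp : 1 ≤ p) {x r : ℝ} (hr : 0 < r)
    (hr1 : r ≤ 1) :
    ‖rightAverage g x (r / 2) - rightAverage g x r‖ₑ ≤
      2 * ENNReal.ofReal r ^ (σ - 1 / p) * gagliardo σ p g := by
  have hp0 : 0 < p := by linarith
  set ρ := ENNReal.ofReal r with hρ
  have hρ0 : ρ ≠ 0 := by simpa [hρ] using hr
  have hρt : ρ ≠ ⊤ := ENNReal.ofReal_ne_top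
  have he : 0 ≤ 1 + σ * p := by positivity
  set I := Ioc x (x + r) with hI
  set G := ∫⁻ x in Ioc (0 : ℝ) 1, ∫⁻ y in Ioc (0 : ℝ) 1,
    ‖g x - g y‖ₑ ^ p / edist (x : UnitAddCircle) (y : UnitAddCircle) ^ (1 + σ * p) with hG
  have hcoe : ∀ y : ℝ, ((y + 1 : ℝ) : UnitAddCircle) = (y : UnitAddCircle) := fun y => by simp
  have hGI : ∫⁻ y in I, ∫⁻ z in I, ‖g z - g y‖ₑ ^ p ≤ G * ρ ^ (1 + σ * p) := by
    have hρe : ρ ^ (1 + σ * p) ≠ ⊤ := ENNReal.rpow_ne_top_of_nonneg he hρt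
    calc ∫⁻ y in I, ∫⁻ z in I, ‖g z - g y‖ₑ ^ p
        ≤ ∫⁻ y in I, ∫⁻ z in I, ‖g y - g z‖ₑ ^ p /
            edist (y : UnitAddCircle) (z : UnitAddCircle) ^ (1 + σ * p) * ρ ^ (1 + σ * p) := by
          refine setLIntegral_mono' measurableSet_Ioc fun y hy =>
            setLIntegral_mono' measurableSet_Ioc fun z hz => ?_
          rw [← enorm_neg, neg_sub]
          refine le_div_mul_of_le ?_ (by simp [hρ0, hρt]) hρe
          refine ENNReal.rpow_le_rpow ((edist_coe_le z y).trans ?_) he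
          apply ENNReal.ofReal_le_ofReal
          rw [abs_le]
          constructor <;> linarith [hy.1, hy.2, hz.1, hz.2]
      _ = (∫⁻ y in I, ∫⁻ z in I, ‖g y - g z‖ₑ ^ p /
            edist (y : UnitAddCircle) (z : UnitAddCircle) ^ (1 + σ * p)) * ρ ^ (1 + σ * p) := by
          simp_rw [lintegral_mul_const' _ _ hρe]
      _ ≤ _ := by
          gcongr
          calc _ ≤ ∫⁻ y in I, ∫⁻ z in Ioc (0 : ℝ) 1, ‖g y - g z‖ₑ ^ p /
                edist (y : UnitAddCircle) (z : UnitAddCircle) ^ (1 + σ * p) := by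
                refine lintegral_mono fun y => ?_
                refine setLIntegral_periodic_mono (fun z => ?_) (by linarith)
                simp only [hper z, hcoe]
            _ ≤ _ := by
                refine setLIntegral_periodic_mono (fun y => ?_) (by linarith)
                simp only [hper y, hcoe]
  have hB : ∀ y, ‖g y - rightAverage g x r‖ₑ ≤ ρ⁻¹ * ∫⁻ z in I, ‖g z - g y‖ₑ := fun y => by
    rw [← enorm_neg, neg_sub]
    exact enorm_rightAverage_sub_le hg hr (g y)
  calc ‖rightAverage g x (r / 2) - rightAverage g x r‖ₑ
      ≤ (ENNReal.ofReal (r / 2))⁻¹ *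
          ∫⁻ y in Ioc x (x + r / 2), ‖g y - rightAverage g x r‖ₑ :=
        enorm_rightAverage_sub_le hg (by linarith) _
    _ ≤ (2 * ρ⁻¹) * ∫⁻ y in I, ρ⁻¹ * ∫⁻ z in I, ‖g z - g y‖ₑ := by
        have : (ENNReal.ofReal (r / 2))⁻¹ = 2 * ρ⁻¹ := by
          rw [ENNReal.ofReal_div_of_pos two_pos, ← hρ, ENNReal.ofReal_ofNat,
            ENNReal.inv_div (by simp) (by simp), div_eq_mul_inv]
        rw [this]
        gcongr
        · exact Ioc_subset_Ioc_right (by linarith)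
        · exact hB _
    _ = 2 * ρ ^ (-2 : ℝ) * ∫⁻ y in I, ∫⁻ z in I, ‖g z - g y‖ₑ := by
        rw [lintegral_const_mul' _ _ (ENNReal.inv_ne_top.2 hρ0), ENNReal.rpow_neg,
          ENNReal.rpow_two, sq, ENNReal.mul_inv (Or.inl hρ0) (Or.inl hρt)]
        ring
    _ ≤ 2 * ρ ^ (-2 : ℝ) * ((G * ρ ^ (1 + σ * p)) ^ (1 / p) * ρ ^ (2 * (1 - 1 / p))) := by
        gcongr
        refine (lintegral_lintegral_le_rpow hg hp x r).trans ?_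
        gcongr
    _ = 2 * (ρ ^ (-2 : ℝ) * ρ ^ ((1 + σ * p) * (1 / p)) * ρ ^ (2 * (1 - 1 / p))) *
          G ^ (1 / p) := by
        rw [ENNReal.mul_rpow_of_nonneg _ _ (by positivity), ← ENNReal.rpow_mul]
        ring
    _ = _ := by
        rw [← ENNReal.rpow_add _ _ hρ0 hρt, ← ENNReal.rpow_add _ _ hρ0 hρt, gagliardo]
        congr 3
        field_simp
        ring

lemma tendsto_rightAverage {g : ℝ → ℝ} (hg : Continuous g) (x : ℝ) :
    Filter.Tendsto (fun n : ℕ => rightAverage g x ((1 / 2) ^ n)) Filter.atTop (nhds (g x)) := by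
  have h := (hg.integral_hasStrictDerivAt x x).hasDerivAt.tendsto_slope_zero
  have h2 : Filter.Tendsto (fun n : ℕ => ((1 / 2) ^ n : ℝ)) Filter.atTop (nhdsWithin 0 {0}ᶜ) := by
    refine tendsto_nhdsWithin_iff.2
      ⟨tendsto_pow_atTop_nhds_zero_of_lt_one (by norm_num) (by norm_num), ?_⟩
    exact Filter.Eventually.of_forall fun n => by simp
  have h3 := h.comp h2
  refine h3.congr fun n => ?_
  simp [rightAverage]

/-- A fractional Morrey inequality: for `σ p > 1` a periodic function of zero mean is bounded by
its Gagliardo seminorm. -/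
lemma exists_enorm_le_gagliardo {σ p : ℝ} (hp : 1 ≤ p) (hσ : 1 / p < σ) :
    ∃ C : ℝ≥0, ∀ g : ℝ → ℝ, Continuous g → Function.Periodic g 1 →
      (∀ x, ∫ z in x..x + 1, g z = 0) → ∀ x, ‖g x‖ₑ ≤ C * gagliardo σ p g := by
  have hp0 : 0 < p := by linarith
  have hσ0 : 0 ≤ σ := le_trans (by positivity) hσ.le
  set q : ℝ≥0∞ := (2⁻¹ : ℝ≥0∞) ^ (σ - 1 / p) with hq
  have hq1 : q < 1 := ENNReal.rpow_lt_one (by simp) (sub_pos.2 hσ)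
  have hC : 2 * (1 - q)⁻¹ ≠ ⊤ :=
    ENNReal.mul_ne_top (by simp) (ENNReal.inv_ne_top.2 (tsub_pos_of_lt hq1).ne')
  refine ⟨(2 * (1 - q)⁻¹).toNNReal, fun g hg hper hmean x => ?_⟩
  rw [ENNReal.coe_toNNReal hC]
  -- Telescoping over `r = 2⁻ⁿ` starts at `r = 1`, where the average vanishes, and ends at `g x`;
  -- the increments are geometric with ratio `q < 1`.
  have hstep : ∀ n : ℕ, ‖rightAverage g x ((1 / 2) ^ (n + 1)) - rightAverage g x ((1 / 2) ^ n)‖ₑ ≤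
      2 * q ^ n * gagliardo σ p g := fun n => by
    have h := enorm_rightAverage_half_sub_le hg hper (σ := σ) hσ0 hp (x := x)
      (r := (1 / 2) ^ n) (by positivity) (pow_le_one₀ (by norm_num) (by norm_num))
    have h2 : ENNReal.ofReal ((1 / 2) ^ n) ^ (σ - 1 / p) = q ^ n := by
      rw [ENNReal.ofReal_pow (by norm_num), one_div, ENNReal.ofReal_inv_of_pos two_pos,
        ENNReal.ofReal_ofNat, hq, ← ENNReal.rpow_natCast, ← ENNReal.rpow_natCast,
        ← ENNReal.rpow_mul, ← ENNReal.rpow_mul, mul_comm, one_div]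
    rw [h2] at h
    rwa [pow_succ, mul_one_div]
  have hsum : ∀ n : ℕ, ‖rightAverage g x ((1 / 2) ^ n)‖ₑ ≤
      2 * (∑ i ∈ Finset.range n, q ^ i) * gagliardo σ p g := fun n => by
    induction n with
    | zero => simp [rightAverage, hmean]
    | succ n ih =>
      rw [Finset.sum_range_succ, mul_add, add_mul]
      calc ‖rightAverage g x ((1 / 2) ^ (n + 1))‖ₑ
          = ‖rightAverage g x ((1 / 2) ^ n) +
              (rightAverage g x ((1 / 2) ^ (n + 1)) - rightAverage g x ((1 / 2) ^ n))‖ₑ := by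
            rw [add_sub_cancel]
        _ ≤ _ := (enorm_add_le _ _).trans (add_le_add ih (hstep n))
  refine le_of_tendsto ((tendsto_rightAverage hg x).enorm) (Filter.Eventually.of_forall fun n =>
    (hsum n).trans ?_)
  gcongr
  rw [← ENNReal.tsum_geometric]
  exact ENNReal.sum_le_tsum _

/-- Above the critical exponent `1 + 1 / p` the Sobolev norm controls the `C¹` norm. -/
theorem exists_enorm_deriv_le_sobolevNorm {s p : ℝ} (hs : 0 ≤ s) (hp : 1 ≤ p)
    (hsp : 1 + 1 / p < s) :
    ∃ C : ℝ≥0, ∀ f : ℝ → ℝ, ContDiff ℝ ∞ f → Function.Periodic f 1 → ∀ x,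
      ‖f x‖ₑ ≤ C * sobolevNorm s p f ∧ ‖deriv f x‖ₑ ≤ C * sobolevNorm s p f := by
  have hp0 : 0 < p := by linarith
  have hpp : 0 < 1 / p := by positivity
  have hk : 1 ≤ ⌊s⌋₊ := (Nat.le_floor_iff hs).2 (by push_cast; linarith)
  have hfun : ∀ f : ℝ → ℝ, ContDiff ℝ ∞ f → Function.Periodic f 1 → ∀ x,
      ‖f x‖ₑ ≤ sobolevNorm s p f := fun f hf hper x => by
    have h := enorm_iteratedDeriv_le_intSobolevNorm hp hf hper (show 0 < ⌊s⌋₊ by omega) x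
    rw [iteratedDeriv_zero] at h
    exact h.trans le_self_add
  -- If `⌊s⌋₊ = 1`, the Morrey inequality applies to `deriv f`, which has zero mean by periodicity.
  -- If `⌊s⌋₊ ≥ 2`, the integer order part already controls `deriv f`.
  rcases hk.eq_or_lt with hk | hk
  · have hne : s ≠ ⌊s⌋₊ := by
      rw [← hk]
      push_cast
      linarith
    obtain ⟨C, hC⟩ := exists_enorm_le_gagliardo hp (σ := s - ⌊s⌋₊) (p := p)
      (by rw [← hk]; push_cast; linarith)
    refine ⟨1 + C, fun f hf hper x => ⟨(hfun f hf hper x).trans ?_, ?_⟩⟩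
    · refine le_mul_of_one_le_left' ?_
      push_cast
      exact le_self_add
    · have hd : Continuous (deriv f) := hf.continuous_deriv (by simp)
      have h := hC (deriv f) hd (periodic_deriv hper) (fun x => by
        rw [intervalIntegral.integral_deriv_eq_sub
          (fun y _ => hf.differentiable (by simp) y) (hd.intervalIntegrable _ _), hper, sub_self]) x
      refine h.trans ?_
      gcongr
      · exact le_add_self
      · rw [sobolevNorm, if_neg hne, ← hk, iteratedDeriv_one]
        exact le_add_self
  · refine ⟨1, fun f hf hper x => ?_⟩
    rw [ENNReal.coe_one, one_mul]
    refine ⟨hfun f hf hper x, ?_⟩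
    have h := enorm_iteratedDeriv_le_intSobolevNorm hp hf hper hk x
    rw [iteratedDeriv_one] at h
    exact h.trans le_self_add

/-! ### Lower bounds for the displacement energy -/

/-- The functional `N` dominates the `C¹` norm on smooth periodic functions. -/
def DominatesC1 (C : ℝ≥0) (N : (ℝ → ℝ) → ℝ≥0∞) : Prop :=
  ∀ f : ℝ → ℝ, ContDiff ℝ ∞ f → Function.Periodic f 1 → ∀ x,
    ‖f x‖ₑ ≤ C * N f ∧ ‖deriv f x‖ₑ ≤ C * N f

lemma enorm_sub_le_of_enorm_hasDerivAt_le {u u' : ℝ → ℝ} {B : ℝ → ℝ≥0∞}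
    (hu : ∀ t ∈ Icc (0 : ℝ) 1, HasDerivAt u (u' t) t) (hu' : ContinuousOn u' (Icc 0 1))
    (hB : ∀ t ∈ Icc (0 : ℝ) 1, ‖u' t‖ₑ ≤ B t) :
    ‖u 1 - u 0‖ₑ ≤ ∫⁻ t in Icc (0 : ℝ) 1, B t := by
  have hI : uIcc (0 : ℝ) 1 = Icc 0 1 := uIcc_of_le zero_le_one
  rw [← intervalIntegral.integral_eq_sub_of_hasDerivAt (a := 0) (b := 1) (f := u) (f' := u')
    (by rwa [hI]) (ContinuousOn.intervalIntegrable (by rwa [hI])),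
    intervalIntegral.integral_of_le zero_le_one, ← integral_Icc_eq_integral_Ioc]
  exact (enorm_integral_le_lintegral_enorm _).trans (setLIntegral_mono' measurableSet_Icc hB)

section Path

variable {Φ : ℝ → ℝ → ℝ} {φ₀ φ₁ : Diffeo} {N : (ℝ → ℝ) → ℝ≥0∞} {C : ℝ≥0}

lemma mul_pathLength (C : ℝ≥0) (N : (ℝ → ℝ) → ℝ≥0∞) (Φ : ℝ → ℝ → ℝ) :
    ∫⁻ t in Icc (0 : ℝ) 1, C * N (velocity Φ t) = C * pathLength N Φ :=
  lintegral_const_mul' _ _ ENNReal.coe_ne_top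

lemma IsPath.hasDerivAt_time (h : IsPath Φ φ₀ φ₁) (x t : ℝ) :
    HasDerivAt (fun τ => Φ τ x) (deriv (fun τ => Φ τ x) t) t :=
  ((contDiff_slice h.smooth x).differentiable (by simp) t).hasDerivAt

lemma IsPath.continuous_deriv_time (h : IsPath Φ φ₀ φ₁) (x : ℝ) :
    Continuous (deriv (fun τ => Φ τ x)) :=
  (contDiff_slice h.smooth x).continuous_deriv (by simp)

/-- A path moves each point by at most a multiple of its length. -/
lemma IsPath.enorm_sub_le (h : IsPath Φ φ₀ φ₁) (hN : DominatesC1 C N) (x : ℝ) :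
    ‖Φ 1 x - Φ 0 x‖ₑ ≤ C * pathLength N Φ := by
  rw [← mul_pathLength]
  refine enorm_sub_le_of_enorm_hasDerivAt_le (fun t _ => h.hasDerivAt_time x t)
    (h.continuous_deriv_time x).continuousOn fun t ht => ?_
  rw [← h.velocity_apply ht]
  exact (hN _ (h.contDiff_velocity ht) (h.periodic_velocity ht) _).1

/-- Along a path the logarithm of the length of an arc changes by at most a multiple of the length
of the path. -/
lemma IsPath.enorm_log_sub_log_le (h : IsPath Φ φ₀ φ₁) (hN : DominatesC1 C N) {x y : ℝ}
    (hxy : x < y) :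
    ‖Real.log (Φ 1 y - Φ 1 x) - Real.log (Φ 0 y - Φ 0 x)‖ₑ ≤ C * pathLength N Φ := by
  have hpos : ∀ t ∈ Icc (0 : ℝ) 1, 0 < Φ t y - Φ t x := fun t ht =>
    sub_pos.2 ((h.diffeo t ht).strictMono hxy)
  have hcy := (contDiff_slice h.smooth y).continuous
  have hcx := (contDiff_slice h.smooth x).continuous
  rw [← mul_pathLength]
  refine enorm_sub_le_of_enorm_hasDerivAt_le (u := fun t => Real.log (Φ t y - Φ t x))
    (u' := fun t => (deriv (fun τ => Φ τ y) t - deriv (fun τ => Φ τ x) t) / (Φ t y - Φ t x))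
    (fun t ht => ((h.hasDerivAt_time y t).sub (h.hasDerivAt_time x t)).log (hpos t ht).ne') ?_
    fun t ht => ?_
  · exact ((h.continuous_deriv_time y).sub (h.continuous_deriv_time x)).continuousOn.div
      (hcy.sub hcx).continuousOn fun t ht => (hpos t ht).ne'
  · have hsm := h.contDiff_velocity ht
    -- The logarithmic derivative of `Φ t y - Φ t x` is a difference quotient of the velocity, hence
    -- a value of its derivative.
    obtain ⟨ξ, -, hξ⟩ := exists_deriv_eq_slope (velocity Φ t) (sub_pos.1 (hpos t ht))
      hsm.continuous.continuousOn (hsm.differentiable (by simp)).differentiableOn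
    rw [h.velocity_apply ht, h.velocity_apply ht] at hξ
    rw [← hξ]
    exact (hN _ hsm (h.periodic_velocity ht) _).2

end Path

lemma ofReal_le_of_enorm_le {r s : ℝ} {L : ℝ≥0∞} (h : r ≤ |s|) (hs : ‖s‖ₑ ≤ L) :
    ENNReal.ofReal r ≤ L := by
  rw [← ofReal_norm] at hs
  exact (ENNReal.ofReal_le_ofReal h).trans hs

/-- An open interval that avoids all integer translates of `(0, 1 - δ)` has length at most `δ`. -/
lemma sub_le_of_forall_notMem {a b δ : ℝ} (hδ0 : 0 < δ) (hδ : δ < 1)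
    (h : ∀ u ∈ Ioo a b, ∀ n : ℤ, u - n ∉ Ioo 0 (1 - δ)) : b - a ≤ δ := by
  by_contra! hab
  set m := ⌊a⌋ with hm
  have hm1 : (m : ℝ) ≤ a := Int.floor_le a
  have hm2 : a < m + 1 := Int.lt_floor_add_one a
  -- Otherwise points just to the right of `a` lie in the translate by `m`. Then `b ≤ m + 1`, since
  -- points just beyond `m + 1` lie in the next translate.
  have ha : m + (1 - δ) ≤ a := by
    by_contra! hlt
    obtain ⟨u, hu1, hu2⟩ := exists_between (lt_min hlt (by linarith : a < b))
    obtain ⟨hu3, hu4⟩ := lt_min_iff.1 hu2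
    exact h u ⟨hu1, hu4⟩ m ⟨by linarith, by linarith⟩
  obtain ⟨u, hu1, hu2⟩ := exists_between
    (lt_min (by linarith : (m + 1 : ℝ) < m + 1 + (1 - δ)) (by linarith : (m + 1 : ℝ) < b))
  obtain ⟨hu3, hu4⟩ := lt_min_iff.1 hu2
  exact h u ⟨by linarith, hu4⟩ (m + 1) ⟨by push_cast; linarith, by push_cast; linarith⟩

/-- The first alternative is the cost of moving the midpoint out of the arc, the second that of
compressing the arc. The second bound degenerates as `δ` approaches `1/2`, so the cases are split at
`1/4`; the first case dictates the `8`. -/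
lemma abs_log_div_eight_le {δ : ℝ} (hδ0 : 0 < δ) (hδ : δ < 1) :
    |Real.log δ| / 8 ≤ (1 - δ) / 2 ∨
      |Real.log δ| / 8 ≤ Real.log (1 - δ) - Real.log δ := by
  rw [abs_of_neg (Real.log_neg hδ0 hδ)]
  rcases le_or_gt (1 / 4) δ with h | h
  · left
    have h1 := Real.one_sub_inv_le_log_of_pos hδ0
    have h2 : δ⁻¹ - 1 ≤ 4 * (1 - δ) := by
      rw [sub_le_iff_le_add, inv_le_iff_one_le_mul₀ hδ0]
      nlinarith
    linarith
  · right
    have h1 : Real.log (1 / 2) ≤ Real.log (1 - δ) := Real.log_le_log (by norm_num) (by linarith)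
    have h2 : Real.log δ ≤ Real.log ((1 / 2) ^ 2) :=
      Real.log_le_log hδ0 (by norm_num; linarith)
    rw [Real.log_pow] at h2
    push_cast at h2
    have h3 : Real.log (1 / 2) < 0 := Real.log_neg (by norm_num) (by norm_num)
    linarith

lemma ofReal_abs_log_le_mul_pathLength {N : (ℝ → ℝ) → ℝ≥0∞} {C : ℝ≥0} (hN : DominatesC1 C N)
    {δ : ℝ} (hδ0 : 0 < δ) (hδ : δ < 1) {φ : Diffeo}
    (hφ : φ.toFun '' arc (Ioo 0 (1 - δ)) ∩ arc (Ioo 0 (1 - δ)) = ∅) {Φ : ℝ → ℝ → ℝ}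
    (hΦ : IsPath Φ Diffeo.id φ) :
    ENNReal.ofReal (|Real.log δ| / 8) ≤ C * pathLength N Φ := by
  have hsource : ∀ x, ∃ n : ℤ, Φ 0 x = x + n := fun x =>
    unitAddCircle_coe_eq_coe_iff.1 (hΦ.source x).symm
  have havoid : ∀ x ∈ Ioo 0 (1 - δ), ∀ n : ℤ, Φ 1 x - n ∉ Ioo 0 (1 - δ) := by
    intro x hx n hn
    refine eq_empty_iff_forall_notMem.1 hφ _ ⟨⟨_, ⟨x, hx, rfl⟩, hΦ.target x⟩, ⟨_, hn, ?_⟩⟩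
    exact unitAddCircle_coe_eq_coe_iff.2 ⟨-n, by push_cast; ring⟩
  have hF0 := hΦ.diffeo 0 (left_mem_Icc.2 zero_le_one)
  have hF1 := hΦ.diffeo 1 (right_mem_Icc.2 zero_le_one)
  rcases abs_log_div_eight_le hδ0 hδ with h | h
  · refine ofReal_le_of_enorm_le ?_ (hΦ.enorm_sub_le hN ((1 - δ) / 2))
    refine h.trans ?_
    -- Moved by less than half the length of the arc, the midpoint would remain in it.
    obtain ⟨n, hn⟩ := hsource ((1 - δ) / 2)
    by_contra! hlt
    rw [hn, abs_lt] at hlt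
    exact havoid ((1 - δ) / 2) ⟨by linarith, by linarith⟩ n
      ⟨by linarith [hlt.1], by linarith [hlt.2]⟩
  · refine ofReal_le_of_enorm_le ?_
      (hΦ.enorm_log_sub_log_le hN (show (0 : ℝ) < 1 - δ by linarith))
    -- `Φ 0` may be any lift of the identity; monotonicity and the shift relation force the same
    -- integer offset at both end points.
    have h0 : Φ 0 (1 - δ) - Φ 0 0 = 1 - δ := by
      obtain ⟨m, hm⟩ := hsource 0
      obtain ⟨n, hn⟩ := hsource (1 - δ)
      have h1 := hF0.strictMono (show (0 : ℝ) < 1 - δ by linarith)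
      have h2 := hF0.strictMono (show 1 - δ < 0 + 1 by linarith)
      rw [hF0.add_one] at h2
      rw [hm, hn] at h1 h2
      have h3 : (m : ℝ) < n + 1 := by linarith
      have h4 : (n : ℝ) < m + 1 := by linarith
      have h5 : m = n := by
        have h3' : m < n + 1 := by exact_mod_cast h3
        have h4' : n < m + 1 := by exact_mod_cast h4
        omega
      rw [hm, hn, h5]
      ring
    have h1 : Φ 1 (1 - δ) - Φ 1 0 ≤ δ := by
      refine sub_le_of_forall_notMem hδ0 hδ fun u hu n => ?_
      obtain ⟨x, rfl⟩ := hF1.surjective u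
      exact havoid x ⟨hF1.strictMono.lt_iff_lt.1 hu.1, hF1.strictMono.lt_iff_lt.1 hu.2⟩ n
    have h2 : Real.log (Φ 1 (1 - δ) - Φ 1 0) ≤ Real.log δ :=
      Real.log_le_log (sub_pos.2 (hF1.strictMono (by linarith))) h1
    rw [h0, abs_sub_comm]
    exact le_trans (by linarith) (le_abs_self _)

theorem exists_abs_log_lt_displacementEnergy {N : (ℝ → ℝ) → ℝ≥0∞} {C : ℝ≥0}
    (hN : DominatesC1 C N) :
    ∃ c : ℝ, 0 < c ∧ ∀ δ : ℝ, 0 < δ → δ < 1 →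
      ENNReal.ofReal (c * |Real.log δ|) < displacementEnergy N (arc (Ioo 0 (1 - δ))) := by
  -- `16` in place of `8` gives strictness, and `C + 1` avoids dividing by zero.
  refine ⟨1 / (16 * (C + 1)), by positivity, fun δ hδ0 hδ => ?_⟩
  have hlog : 0 < |Real.log δ| := abs_pos.2 (Real.log_neg hδ0 hδ).ne
  have hC1 : (0 : ℝ) < C + 1 := by positivity
  have hlt : ENNReal.ofReal (1 / (16 * (C + 1)) * |Real.log δ|) <
      ENNReal.ofReal (|Real.log δ| / 8 / (C + 1)) := by
    rw [ENNReal.ofReal_lt_ofReal_iff (by positivity)]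
    have : |Real.log δ| / 8 / (C + 1) = 2 * (1 / (16 * (C + 1)) * |Real.log δ|) := by
      field_simp
      norm_num
    rw [this]
    have : 0 < 1 / (16 * ((C : ℝ) + 1)) * |Real.log δ| := by positivity
    linarith
  refine hlt.trans_le (le_iInf₂ fun φ hφ => le_iInf₂ fun Φ hΦ => ?_)
  rw [ENNReal.ofReal_div_of_pos hC1]
  refine ENNReal.div_le_of_le_mul' ((ofReal_abs_log_le_mul_pathLength hN hδ0 hδ hφ hΦ).trans ?_)
  gcongr
  rw [ENNReal.ofReal_add C.coe_nonneg zero_le_one, ENNReal.ofReal_coe_nnreal]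
  exact le_self_add

/-! ### Equivalent norms -/

lemma EquivSobolevNorm.sublinearOnControlled {s p : ℝ} {N : (ℝ → ℝ) → ℝ≥0∞}
    (hN : EquivSobolevNorm s p N) (h : SublinearOnControlled (sobolevNorm s p)) :
    SublinearOnControlled N := by
  obtain ⟨K, hK⟩ := hN
  obtain ⟨C, θ, hθ, hC⟩ := h
  refine ⟨K * C, θ, hθ, fun M hM v hv => (hK v hv.smooth hv.periodic).1.trans ?_⟩
  rw [ENNReal.coe_mul, mul_assoc]
  gcongr
  exact hC M hM v hv

lemma EquivSobolevNorm.exists_dominatesC1 {s p : ℝ} {N : (ℝ → ℝ) → ℝ≥0∞}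
    (hN : EquivSobolevNorm s p N) (hs : 0 ≤ s) (hp : 1 ≤ p) (hsp : 1 + 1 / p < s) :
    ∃ C : ℝ≥0, DominatesC1 C N := by
  obtain ⟨K, hK⟩ := hN
  obtain ⟨C, hC⟩ := exists_enorm_deriv_le_sobolevNorm hs hp hsp
  refine ⟨C * K, fun f hf hper x => ?_⟩
  have h : C * sobolevNorm s p f ≤ (C * K : ℝ≥0) * N f := by
    rw [ENNReal.coe_mul, mul_assoc]
    gcongr
    exact (hK f hf hper).2
  exact ⟨(hC f hf hper x).1.trans h, (hC f hf hper x).2.trans h⟩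

end CircleDiff

end

theorem mainTheorem9 (s p : ℝ) (hs : 0 ≤ s) (hp : 1 ≤ p) :
    (∀ I : Set ℝ, I.OrdConnected → volume I < 1 / 2 →
      CircleDiff.displacementEnergy (CircleDiff.sobolevNorm s p) (CircleDiff.arc I) ≤ 1 / 2) ∧
    ∀ N : (ℝ → ℝ) → ℝ≥0∞, CircleDiff.EquivSobolevNorm s p N →
      (s < 1 + 1 / p →
        ∃ C : ℝ, 0 < C ∧ ∀ a b : ℝ, b - a < 1 →
          CircleDiff.displacementEnergy N (CircleDiff.arc (Ioo a b)) < ENNReal.ofReal C) ∧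
      (1 + 1 / p < s →
        ∃ c : ℝ, 0 < c ∧ ∀ δ : ℝ, 0 < δ → δ < 1 →
          ENNReal.ofReal (c * |Real.log δ|) <
            CircleDiff.displacementEnergy N (CircleDiff.arc (Ioo 0 (1 - δ)))) := by
  refine ⟨fun I hI hvol => CircleDiff.displacementEnergy_arc_le_half hp hI hvol,
    fun N hN => ⟨fun hsp => ?_, fun hsp => ?_⟩⟩
  · exact CircleDiff.exists_displacementEnergy_arc_lt
      (hN.sublinearOnControlled (CircleDiff.sublinearOnControlled_sobolevNorm hs hp hsp))
  · obtain ⟨C, hC⟩ := hN.exists_dominatesC1 hs hp hsp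
    exact CircleDiff.exists_abs_log_lt_displacementEnergy hC
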